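/- Conventions. Let $m\ge 1$ and let $\mathcal L\subset\mathbb R^m$ be a lattice (a discrete subgroup). Its dual is $\mathcal L^*=\{z\in\mathbb R^m:\langle z,v\rangle\in\mathbb Z\ \text{for all } v\in\mathcal L\}$, and $\det\mathcal L$ is the volume of a fundamental domain of $\mathcal L$. $B(L)$ is the closed Euclidean ball of radius $L>0$ about the origin. Let $X$ be a random variable on $\mathcal L$ that is isotropic, i.e. $\mathbb E\,XX^\dagger=I_m$. For $\theta\in\mathbb R^m$ put $\tilde X(\theta)=\sqrt{\mathbb E\,|\langle\theta,X\rangle \bmod 1|^2}$, where $y\bmod 1$ is taken in $(-1/2,1/2]$; call $\theta$ pseudodual if $\tilde X(\theta)\le \tfrac12 d(\theta,\mathcal L^*)$, with $d$ the Euclidean distance. The spanningness of $X$ is $$s(X)=\inf\{\tilde X(\theta): \theta\notin\mathcal L^*,\ \theta\text{ pseudodual}\}\in[0,\infty]$$ (so $s(X)=\infty$ if there is no such $\theta$). For a constant $c_0>0$ put $$N_0=c_0\max\left\{m^2L^2(\log m+\log L)^2,\ s(X)^{-4}L^{-2},\ L^2(\log\det\mathcal L)^2\right\}\in[0,\infty].$$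 For a real $m\times n$ matrix $M$ with $MM^\dagger$ invertible, the lattice Gaussian is $$G_M(\lambda)=\frac{2^{m/2}\det\mathcal L}{\pi^{m/2}\sqrt{\det(MM^\dagger)}}\,e^{-2\lambda^\dagger(MM^\dagger)^{-1}\lambda}.$$ $A\succeq B$ means that $A-B$ is positive semidefinite, and $\mathbf 1$ is the all-ones vector. Theorem. There are absolute constants $c_0,c_1>0$ such that the following holds. Let $X$ be a random variable on a lattice $\mathcal L\subset\mathbb R^m$ with $\mathbb E\,XX^\dagger=I_m$, $\operatorname{supp}X\subset B(L)$ and $\mathcal L=\operatorname{span}_{\mathbb Z}\operatorname{supp}X$. Let $n\ge 2$ be an integer with $n\ge N_0$, and let $M$ be the random $m\times n$ matrix whose columns are independent copies of $X$. Then with probability at least $1-c_1L\sqrt{\frac{\log n}{n}}$ over the choice of $M$, both of the following properties hold: 1. $MM^\dagger\succeq \frac n2 I_m$. 2. For all $\lambda\in\mathcal L-\frac12M\mathbf 1$, with $y$ uniform in $\{\pm1/2\}^n$, $$\left|\Pr_y[My=\lambda]-G_M(\lambda)\right|\le G_M(0)\cdot\frac{2m^2L^2}{n}.$$ In particular, when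 these hold, $\Pr_y[My=\lambda]>0$ for every $\lambda\in\mathcal L-\frac12M\mathbf 1$ with $e^{-2\lambda^\dagger(MM^\dagger)^{-1}\lambda}>2m^2L^2/n$. -/

import Mathlib

open MeasureTheory
open scoped ENNReal

namespace LatticeLLT

noncomputable section

/-- `ℝ^m` with its Euclidean norm. -/
abbrev E (m : ℕ) : Type := EuclideanSpace ℝ (Fin m)

/-- The matrix `𝔼 X X†` of a random vector `X` with law `μ`. -/
def secondMoment {m : ℕ} (μ : Measure (E m)) : Matrix (Fin m) (Fin m) ℝ :=
  Matrix.of fun i j => ∫ x, x i * x j ∂μ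

/-- `𝓛* = {z : ⟨z, v⟩ ∈ ℤ for all v ∈ 𝓛}`. -/
def dualLattice {m : ℕ} (𝓛 : Submodule ℤ (E m)) : Submodule ℤ (E m) :=
  LinearMap.BilinForm.dualSubmodule (innerₗ (E m)) 𝓛

theorem mem_dualLattice {m : ℕ} (𝓛 : Submodule ℤ (E m)) (z : E m) :
    z ∈ dualLattice 𝓛 ↔ ∀ v ∈ 𝓛, ∃ k : ℤ, inner ℝ z v = (k : ℝ) := by
  simp only [dualLattice, LinearMap.BilinForm.mem_dualSubmodule, Submodule.mem_one,
    innerₗ_apply_apply]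
  refine forall₂_congr fun v _ => exists_congr fun k => ?_
  rw [eq_comm]
  simp

/-- `y mod 1`, taken in `(-1/2, 1/2]`. -/
def centeredMod (y : ℝ) : ℝ := y - (⌈y - 1 / 2⌉ : ℝ)

theorem centeredMod_mem (y : ℝ) : centeredMod y ∈ Set.Ioc (-(1 / 2) : ℝ) (1 / 2) := by
  have h1 := Int.le_ceil (y - 1 / 2)
  have h2 := Int.ceil_lt_add_one (y - 1 / 2)
  constructor <;> unfold centeredMod <;> linarith

/-- `X̃(θ) = √(𝔼 |⟨θ, X⟩ mod 1|²)`, where `X` has law `μ`. -/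
def tilde {m : ℕ} (μ : Measure (E m)) (θ : E m) : ℝ :=
  Real.sqrt (∫ x, |centeredMod (inner ℝ θ x)| ^ 2 ∂μ)

/-- `θ` is pseudodual if `X̃(θ) ≤ d(θ, 𝓛*) / 2`, with the Euclidean distance `d`. -/
def IsPseudodual {m : ℕ} (μ : Measure (E m)) (𝓛 : Submodule ℤ (E m)) (θ : E m) : Prop :=
  tilde μ θ ≤ Metric.infDist θ (dualLattice 𝓛 : Set (E m)) / 2

/-- The spanningness `s(X)` of an isotropic `X` with law `μ` on `𝓛`: the infimum of `X̃(θ)` over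
the pseudodual `θ ∉ 𝓛*`; it is `∞` if there is no such `θ`. -/
def spanningness {m : ℕ} (μ : Measure (E m)) (𝓛 : Submodule ℤ (E m)) : ℝ≥0∞ :=
  ⨅ (θ : E m) (_ : θ ∉ dualLattice 𝓛) (_ : IsPseudodual μ 𝓛 θ), ENNReal.ofReal (tilde μ θ)

/-- `c · max {m² L² (log m + log L)², s⁻⁴ L⁻², L² (log d)²}`. It is `[0, ∞]`-valued, so that
`s⁻⁴ = ∞` for `s = 0` and `s⁻⁴ = 0` for `s = ∞`. -/
def threshold (c : ℝ) (m : ℕ) (s : ℝ≥0∞) (L d : ℝ) : ℝ≥0∞ :=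
  ENNReal.ofReal c *
    max (ENNReal.ofReal ((m : ℝ) ^ 2 * L ^ 2 * (Real.log m + Real.log L) ^ 2))
      (max (s⁻¹ ^ 4 * ENNReal.ofReal ((L ^ 2)⁻¹))
        (ENNReal.ofReal (L ^ 2 * Real.log d ^ 2)))

/-- The `m × n` matrix with the given columns. -/
def colMatrix {m n : ℕ} (x : Fin n → E m) : Matrix (Fin m) (Fin n) ℝ :=
  Matrix.of fun i j => x j i

open scoped Classical in
/-- The cube `{1/2, -1/2}^n`. -/
def halfCube (n : ℕ) : Finset (Fin n → ℝ) :=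
  Fintype.piFinset fun _ => {1 / 2, -(1 / 2)}

open scoped Classical in
/-- `Pr_y [M y = v]` for `y` uniform in `{1/2, -1/2}^n`. -/
def hitProb {m n : ℕ} (M : Matrix (Fin m) (Fin n) ℝ) (v : E m) : ℝ :=
  (((halfCube n).filter fun y => M.mulVec y = v.ofLp).card : ℝ) / ((halfCube n).card : ℝ)

/-- The translate `𝓛 - ½ M 𝟏`. -/
def shiftedLattice {m n : ℕ} (𝓛 : Submodule ℤ (E m)) (M : Matrix (Fin m) (Fin n) ℝ) :
    Set (E m) :=
  {v | ∃ w ∈ 𝓛, v = w - (1 / 2 : ℝ) • WithLp.toLp 2 (M.mulVec 1)}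

/-- `exp(-2 v† (M M†)⁻¹ v)`. -/
def gaussExp {m n : ℕ} (M : Matrix (Fin m) (Fin n) ℝ) (v : E m) : ℝ :=
  Real.exp (-2 * (v.ofLp ⬝ᵥ (M * M.transpose)⁻¹.mulVec v.ofLp))

/-- The lattice Gaussian
`G_M(v) = 2^{m/2} det 𝓛 / (π^{m/2} √(det (M M†))) · exp(-2 v† (M M†)⁻¹ v)`. -/
def latticeGaussian {m n : ℕ} (𝓛 : Submodule ℤ (E m)) (M : Matrix (Fin m) (Fin n) ℝ)
    (v : E m) : ℝ :=
  (2 : ℝ) ^ ((m : ℝ) / 2) * ZLattice.covolume 𝓛 /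
      (Real.pi ^ ((m : ℝ) / 2) * Real.sqrt (M * M.transpose).det) * gaussExp M v

/-- The two properties of the matrix `M`, with the consequence of the second one:
`M M† ⪰ (n/2) I`; the local limit estimate at every point of `𝓛 - ½ M 𝟏`; and every
point of `𝓛 - ½ M 𝟏` at which the Gaussian exponential exceeds the relative error is hit. -/
def GoodMatrix {m n : ℕ} (𝓛 : Submodule ℤ (E m)) (L : ℝ) (M : Matrix (Fin m) (Fin n) ℝ) :
    Prop :=
  (M * M.transpose - ((n : ℝ) / 2) • (1 : Matrix (Fin m) (Fin m) ℝ)).PosSemidef ∧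
  (∀ v ∈ shiftedLattice 𝓛 M,
    |hitProb M v - latticeGaussian 𝓛 M v| ≤
      latticeGaussian 𝓛 M 0 * (2 * (m : ℝ) ^ 2 * L ^ 2 / n)) ∧
  (∀ v ∈ shiftedLattice 𝓛 M,
    2 * (m : ℝ) ^ 2 * L ^ 2 / n < gaussExp M v → 0 < hitProb M v)

end

end LatticeLLT

open LatticeLLT

/-!
Let `r = 1 / (4L)`. Fourier inversion writes `Pr [M y = v]` as `det 𝓛` times the integral of
`e^{-2πi⟪v, θ⟫} ∏ⱼ cos (π⟪θ, xⱼ⟫)` over a fundamental domain `D` of the dual lattice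
(`hitProb_eq_setIntegral`), where `x₁, …, xₙ` are the columns of `M`. A Gaussian integral writes
the lattice Gaussian as the integral over the whole space with the product of cosines replaced by
`exp (-(π²/2) θᵀ M Mᵀ θ)` (`latticeGaussian_eq_integral`). Isotropy forces nonzero dual vectors to
have length at least `1 / L`, so `D` can be chosen to contain the closed ball of radius `r`
and to be otherwise at distance more than `r` from the dual lattice (`exists_dual_domain`).

The two integrals differ by three terms (`abs_hitProb_sub_latticeGaussian_le`).

* On the ball, `1 - ∏ cos tⱼ exp (tⱼ² / 2) ≤ ∑ tⱼ⁴ / 4`. If `M Mᵀ ≥ (n/2) I`, then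
  `∑ⱼ ⟪θ, xⱼ⟫⁴ ≤ L² ‖θ‖² θᵀ M Mᵀ θ ≤ (2L²/n) (θᵀ M Mᵀ θ)²`, and the Gaussian mean of the square of
  the quadratic form is `m (m + 2) / π⁴`. The relative error is at most `m (m + 2) L² / (2n)`.
* The Gaussian outside of the ball is exponentially small in `n / L²`.
* The remaining part of `D` is bounded on average over `M`. Since `|cos πt| ≤ 1 - 2 (t mod 1)²`,
  the mean of the product of cosines is at most `exp (-2n X̃(θ)²)`, and on this part of `D` either
  `θ` is pseudodual and `X̃(θ) ≥ s(X)`, or `X̃(θ) ≥ r / 2`. Under the hypothesis on `n` both bounds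
  give `X̃(θ)² ≥ 1 / (L √n)`, so that the mean is at most `exp (-2 √n / L)`, which beats the
  polynomial factors in `n` and the volume `1 / det 𝓛` of `D`. Markov's inequality concludes
  (`measure_setIntegral_prod_abs_cos_le`, `far_probability_le`).

Finally, `M Mᵀ ≥ (n/2) I` holds if the Frobenius norm of `M Mᵀ - n I` is at most `n/2`. By
Markov's inequality for its square, this fails with probability at most `4 m L² / n`
(`measure_frobenius_le`), which is less than `L / √n` because `√n` is a large multiple of `m L`.
-/

namespace LatticeLLT

section DualLattice

open scoped Pointwise

/-! ### The dual lattice and its fundamental domains -/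

theorem inner_nondegenerate (m : ℕ) : (innerₗ (E m)).Nondegenerate := by
  rw [LinearMap.IsRefl.nondegenerate_iff_separatingLeft]
  · intro x hx
    exact inner_self_eq_zero.mp (hx x)
  · intro x y h
    simpa [real_inner_comm] using h

/-- The fundamental parallelepipeds of a basis and of its dual basis have reciprocal volumes. -/
theorem volume_fundamentalDomain_mul_dual {m : ℕ} {ι : Type*} [Fintype ι] [DecidableEq ι]
    (b : Module.Basis ι ℝ (E m)) :
    volume.real (ZSpan.fundamentalDomain b) *
      volume.real (ZSpan.fundamentalDomain
        (LinearMap.BilinForm.dualBasis (innerₗ (E m)) (inner_nondegenerate m) b)) = 1 := by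
  set bd := LinearMap.BilinForm.dualBasis (innerₗ (E m)) (inner_nondegenerate m) b with hbd
  have e : Fin m ≃ ι := (EuclideanSpace.basisFun (Fin m) ℝ).toBasis.indexEquiv b
  let o := (EuclideanSpace.basisFun (Fin m) ℝ).reindex e
  have ho : volume.real (ZSpan.fundamentalDomain o.toBasis) = 1 := by
    rw [measureReal_congr (ZSpan.fundamentalDomain_ae_parallelepiped o.toBasis volume)]
    simp [measureReal_def, o.volume_parallelepiped]
  have hdet : o.toBasis.det b * o.toBasis.det bd = 1 := by
    rw [Module.Basis.det_apply, Module.Basis.det_apply, ← Matrix.det_transpose, ← Matrix.det_mul]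
    convert! Matrix.det_one (n := ι) (R := ℝ)
    ext i j
    have h1 : inner ℝ (b i) (bd j) = (1 : Matrix ι ι ℝ) i j := by
      have := LinearMap.BilinForm.apply_dualBasis_left (inner_nondegenerate m) b j i
      rw [real_inner_comm]
      simpa [Matrix.one_apply] using this
    rw [← h1, ← o.sum_inner_mul_inner]
    simp [Matrix.mul_apply, Module.Basis.toMatrix_apply, o.repr_apply_apply, real_inner_comm]
  rw [ZSpan.measureReal_fundamentalDomain b volume o.toBasis,
    ZSpan.measureReal_fundamentalDomain bd volume o.toBasis, ho, mul_one, mul_one, ← abs_mul, hdet,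
    abs_one]

/-- The dual of a lattice basis spans the dual lattice, and its fundamental parallelepiped has
volume `1 / det 𝓛`. -/
theorem exists_dual_basis {m : ℕ} (𝓛 : Submodule ℤ (E m)) [DiscreteTopology 𝓛]
    [IsZLattice ℝ 𝓛] :
    ∃ b : Module.Basis (Module.Free.ChooseBasisIndex ℤ 𝓛) ℝ (E m),
      dualLattice 𝓛 = Submodule.span ℤ (Set.range b) ∧
      volume.real (ZSpan.fundamentalDomain b) = (ZLattice.covolume 𝓛)⁻¹ := by
  classical
  let c := Module.Free.chooseBasis ℤ 𝓛
  let bR := c.ofZLatticeBasis ℝ 𝓛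
  refine ⟨LinearMap.BilinForm.dualBasis (innerₗ (E m)) (inner_nondegenerate m) bR, ?_, ?_⟩
  · rw [← LinearMap.BilinForm.dualSubmodule_span_of_basis, dualLattice,
      Module.Basis.ofZLatticeBasis_span]
  · rw [ZLattice.covolume_eq_measure_fundamentalDomain 𝓛 volume
      (ZLattice.isAddFundamentalDomain c volume)]
    exact eq_inv_of_mul_eq_one_right (volume_fundamentalDomain_mul_dual bR)

theorem countable_dualLattice {m : ℕ} (𝓛 : Submodule ℤ (E m)) [DiscreteTopology 𝓛]
    [IsZLattice ℝ 𝓛] : Countable (dualLattice 𝓛) := by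
  obtain ⟨b, hb, -⟩ := exists_dual_basis 𝓛
  rw [hb]
  infer_instance

/-- If the closed ball of radius `r` is disjoint from its translates by dual vectors, it can be
completed to a fundamental domain of the dual lattice: the rest of the domain is the part of a
fundamental parallelepiped that lies at distance more than `r` from the dual lattice. -/
theorem exists_dual_domain {m : ℕ} (𝓛 : Submodule ℤ (E m)) [DiscreteTopology 𝓛]
    [IsZLattice ℝ 𝓛] {r : ℝ} (hsep : ∀ z ∈ dualLattice 𝓛, z ≠ 0 → 2 * r < ‖z‖) :
    ∃ D : Set (E m), MeasurableSet D ∧ Metric.closedBall 0 r ⊆ D ∧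
      IsAddFundamentalDomain (dualLattice 𝓛) D volume ∧
      volume.real D = (ZLattice.covolume 𝓛)⁻¹ ∧ volume D ≠ ⊤ ∧
      ∀ θ ∈ D \ Metric.closedBall 0 r, ∀ z ∈ dualLattice 𝓛, r < dist θ z := by
  obtain ⟨b, hb, hvol⟩ := exists_dual_basis 𝓛
  have hcount := countable_dualLattice 𝓛
  let P := ZSpan.fundamentalDomain b
  have hPmeas : MeasurableSet P := ZSpan.fundamentalDomain_measurableSet b
  have hPex : ∀ x : E m, ∃! g : dualLattice 𝓛, g +ᵥ x ∈ P := by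
    rw [hb]
    exact fun x => ZSpan.exist_unique_vadd_mem_fundamentalDomain b x
  have hPdom : IsAddFundamentalDomain (dualLattice 𝓛) P volume :=
    .mk' hPmeas.nullMeasurableSet hPex
  have hPtop : volume P ≠ ⊤ := (ZSpan.fundamentalDomain_isBounded b).measure_lt_top.ne
  let U : Set (E m) := ⋃ z : dualLattice 𝓛, Metric.closedBall (z : E m) r
  have hUmeas : MeasurableSet U := MeasurableSet.iUnion fun z => measurableSet_closedBall
  have hUinv : ∀ (g : dualLattice 𝓛) (x : E m), g +ᵥ x ∈ U → x ∈ U := by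
    intro g x hx
    obtain ⟨z, hz⟩ := Set.mem_iUnion.mp hx
    refine Set.mem_iUnion.mpr ⟨z - g, ?_⟩
    rw [Metric.mem_closedBall, dist_eq_norm] at hz ⊢
    convert hz using 2
    change x - ((z : E m) - (g : E m)) = (g : E m) + x - (z : E m)
    abel
  have hball : Metric.closedBall 0 r ⊆ U := by
    intro x hx
    exact Set.mem_iUnion.mpr ⟨0, by simpa using hx⟩
  let D : Set (E m) := Metric.closedBall 0 r ∪ (P \ U)
  have hDmeas : MeasurableSet D := measurableSet_closedBall.union (hPmeas.diff hUmeas)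
  have hDex : ∀ x : E m, ∃! g : dualLattice 𝓛, g +ᵥ x ∈ D := by
    intro x
    by_cases hx : x ∈ U
    · obtain ⟨z, hz⟩ := Set.mem_iUnion.mp hx
      have hz' : ‖x - (z : E m)‖ ≤ r := by simpa [dist_eq_norm] using hz
      refine ⟨-z, Or.inl ?_, ?_⟩
      · change -(z : E m) + x ∈ _
        rwa [mem_closedBall_zero_iff, neg_add_eq_sub]
      · rintro g (hg | hg)
        · have hg' : ‖(g : E m) + x‖ ≤ r := mem_closedBall_zero_iff.mp hg
          by_contra hne
          have h1 : ((g + z : dualLattice 𝓛) : E m) ≠ 0 := by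
            intro h
            exact hne (eq_neg_of_add_eq_zero_left (Subtype.ext h))
          have h2 := hsep _ (g + z).2 h1
          have h3 : ((g + z : dualLattice 𝓛) : E m) = ((g : E m) + x) - (x - z) := by
            push_cast; abel
          rw [h3] at h2
          linarith [norm_sub_le ((g : E m) + x) (x - z)]
        · refine absurd ?_ hg.2
          refine hUinv (-g) _ ?_
          rwa [neg_vadd_vadd]
    · obtain ⟨g, hg, hg'⟩ := hPex x
      refine ⟨g, Or.inr ⟨hg, fun h => hx (hUinv g x h)⟩, ?_⟩
      rintro g' (h | h)
      · exact absurd (hUinv g' x (hball h)) hx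
      · exact hg' g' h.1
  have hDdom : IsAddFundamentalDomain (dualLattice 𝓛) D volume :=
    .mk' hDmeas.nullMeasurableSet hDex
  have : MeasurableVAdd (dualLattice 𝓛) (E m) :=
    (inferInstance : MeasurableVAdd (dualLattice 𝓛).toAddSubgroup (E m))
  have : VAddInvariantMeasure (dualLattice 𝓛) (E m) volume :=
    (inferInstance : VAddInvariantMeasure (dualLattice 𝓛).toAddSubgroup (E m) volume)
  have hDP : volume D = volume P := hDdom.measure_eq hPdom
  refine ⟨D, hDmeas, Set.subset_union_left, hDdom, ?_, hDP ▸ hPtop, ?_⟩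
  · rw [measureReal_def, hDP, ← measureReal_def, hvol]
  · rintro θ ⟨hθ | hθ, hn⟩ z hz
    · exact absurd hθ hn
    · by_contra! h
      exact hθ.2 (Set.mem_iUnion.mpr ⟨⟨z, hz⟩, h⟩)

/-- Orthogonality of characters: a nonzero `v` in the lattice gives a character of mean zero on
every fundamental domain of the dual lattice. -/
theorem setIntegral_character {m : ℕ} {𝓛 : Submodule ℤ (E m)} [DiscreteTopology 𝓛]
    [IsZLattice ℝ 𝓛] {D : Set (E m)}
    (hD : IsAddFundamentalDomain (dualLattice 𝓛) D volume) {v : E m} (hv : v ∈ 𝓛) :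
    ∫ θ in D, Complex.exp (2 * Real.pi * Complex.I * (inner ℝ v θ : ℝ)) =
      if v = 0 then (volume.real D : ℂ) else 0 := by
  split_ifs with h0
  · simp [h0]
  have hcount := countable_dualLattice 𝓛
  have : MeasurableVAdd (dualLattice 𝓛) (E m) :=
    (inferInstance : MeasurableVAdd (dualLattice 𝓛).toAddSubgroup (E m))
  have : VAddInvariantMeasure (dualLattice 𝓛) (E m) volume :=
    (inferInstance : VAddInvariantMeasure (dualLattice 𝓛).toAddSubgroup (E m) volume)
  have : VAddCommClass (E m) (dualLattice 𝓛) (E m) :=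
    ⟨fun a b c => by
      change a + ((b : E m) + c) = (b : E m) + (a + c)
      abel⟩
  let f : E m → ℂ := fun θ => Complex.exp (2 * Real.pi * Complex.I * (inner ℝ v θ : ℝ))
  -- translating by `a`, where `⟨v, a⟩ = 1/2`, changes the sign of the character
  let a : E m := (1 / (2 * ‖v‖ ^ 2)) • v
  have hva : inner ℝ v a = (1 / 2 : ℝ) := by
    have : ‖v‖ ≠ 0 := norm_ne_zero_iff.mpr h0
    simp only [a, inner_smul_right, real_inner_self_eq_norm_sq]
    field_simp
  have hinv : ∀ (g : dualLattice 𝓛) (x : E m), f (g +ᵥ x) = f x := by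
    intro g x
    obtain ⟨k, hk⟩ := (mem_dualLattice 𝓛 g).mp g.2 v hv
    change Complex.exp (2 * Real.pi * Complex.I * (inner ℝ v ((g : E m) + x) : ℝ)) = _
    rw [inner_add_right, real_inner_comm, hk]
    push_cast
    rw [mul_add, Complex.exp_add, mul_comm _ (k : ℂ), Complex.exp_int_mul_two_pi_mul_I, one_mul]
  have hDa : IsAddFundamentalDomain (dualLattice 𝓛) (a +ᵥ D) volume := hD.vadd_of_comm a
  have h1 := hDa.setIntegral_eq hD hinv
  have h2 : ∫ θ in a +ᵥ D, f θ = ∫ θ in D, f (a + θ) :=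
    (measurePreserving_vadd a volume).setIntegral_image_emb (measurableEmbedding_const_vadd a) f D
  have h3 : ∀ θ, f (a + θ) = -f θ := by
    intro θ
    change Complex.exp _ = - Complex.exp _
    rw [inner_add_right, hva]
    push_cast
    rw [mul_add, Complex.exp_add,
      show 2 * (Real.pi : ℂ) * Complex.I * (1 / 2) = Real.pi * Complex.I by ring,
      Complex.exp_pi_mul_I]
    ring
  rw [h2] at h1
  simp only [h3, integral_neg] at h1
  exact self_eq_neg.mp h1.symm

end DualLattice

/-! ### Gaussian integrals -/

/-- A positive definite `Q` is `TᵀT` for a linear map `T`. In the coordinate `T θ` the quadratic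
form of `Q` is the squared norm, and a functional `⟪v, ·⟫` becomes `⟪w, ·⟫` with
`‖w‖² = vᵀ Q⁻¹ v`. -/
theorem exists_linearMap_of_posDef {m : ℕ} {Q : Matrix (Fin m) (Fin m) ℝ} (hQ : Q.PosDef) :
    ∃ T : E m →ₗ[ℝ] E m, |LinearMap.det T| = Real.sqrt Q.det ∧
      (∀ θ, ‖T θ‖ ^ 2 = θ.ofLp ⬝ᵥ Q.mulVec θ.ofLp) ∧
      ∀ v : E m, ∃ w : E m, (∀ θ, inner ℝ v θ = inner ℝ w (T θ)) ∧
        ‖w‖ ^ 2 = v.ofLp ⬝ᵥ Q⁻¹.mulVec v.ofLp := by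
  obtain ⟨B, hB⟩ : ∃ B : Matrix (Fin m) (Fin m) ℝ, Q = B.transpose * B := by
    open scoped MatrixOrder in
    obtain ⟨B, hB⟩ := CStarAlgebra.nonneg_iff_eq_star_mul_self.mp hQ.posSemidef.nonneg
    exact ⟨B, by simpa [Matrix.star_eq_conjTranspose] using hB⟩
  have hdet : Q.det = B.det ^ 2 := by rw [hB, Matrix.det_mul, Matrix.det_transpose, sq]
  have hB0 : IsUnit B.det := by
    rw [isUnit_iff_ne_zero]
    intro h
    have := hQ.det_pos
    simp [hdet, h] at this
  have hnorm : ∀ u : Fin m → ℝ, ‖WithLp.toLp 2 u‖ ^ 2 = u ⬝ᵥ u := by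
    intro u
    rw [EuclideanSpace.norm_sq_eq]
    simp [dotProduct, sq]
  refine ⟨Matrix.toLpLin 2 2 B, ?_, ?_, ?_⟩
  · rw [hdet, Real.sqrt_sq_eq_abs]
    congr 1
    rw [Matrix.toLpLin_eq_toLin, LinearMap.det_toLin]
  · intro θ
    rw [Matrix.toLpLin_apply, hnorm, hB, ← Matrix.mulVec_mulVec, Matrix.dotProduct_mulVec,
      Matrix.dotProduct_mulVec, Matrix.vecMul_transpose, Matrix.dotProduct_mulVec]
  · intro v
    refine ⟨WithLp.toLp 2 ((B.transpose)⁻¹.mulVec v.ofLp), ?_, ?_⟩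
    · intro θ
      have h1 : ∀ x y : E m, inner ℝ x y = x.ofLp ⬝ᵥ y.ofLp := by
        intro x y
        simp [EuclideanSpace.inner_eq_star_dotProduct, dotProduct_comm]
      rw [h1, h1, Matrix.toLpLin_apply]
      simp only
      rw [Matrix.dotProduct_mulVec, ← Matrix.mulVec_transpose, Matrix.mulVec_mulVec,
        Matrix.mul_nonsing_inv _ (by rwa [Matrix.det_transpose]), Matrix.one_mulVec]
    · rw [hnorm, hB, Matrix.mul_inv_rev, ← Matrix.mulVec_mulVec,
        Matrix.dotProduct_mulVec v.ofLp, ← Matrix.mulVec_transpose, Matrix.transpose_nonsing_inv]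

theorem measurableEmbedding_of_det_ne_zero {m : ℕ} {T : E m →ₗ[ℝ] E m}
    (hT : LinearMap.det T ≠ 0) : MeasurableEmbedding T :=
  (LinearEquiv.ofIsUnitDet (f := T) (v := Module.finBasis ℝ (E m))
    (v' := Module.finBasis ℝ (E m)) (by rw [LinearMap.det_toMatrix]; exact hT.isUnit)
    ).toContinuousLinearEquiv.toHomeomorph.measurableEmbedding

theorem integral_comp_linearMap {m : ℕ} {F : Type*} [NormedAddCommGroup F] [NormedSpace ℝ F]
    {T : E m →ₗ[ℝ] E m} (hT : LinearMap.det T ≠ 0) (f : E m → F) :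
    ∫ θ, f (T θ) = |LinearMap.det T|⁻¹ • ∫ φ, f φ := by
  have hemb := measurableEmbedding_of_det_ne_zero hT
  rw [← hemb.integral_map, Measure.map_linearMap_addHaar_eq_smul_addHaar _ hT,
    integral_smul_measure, ENNReal.toReal_ofReal (abs_nonneg _), abs_inv]

theorem integrable_comp_linearMap {m : ℕ} {F : Type*} [NormedAddCommGroup F]
    {T : E m →ₗ[ℝ] E m} (hT : LinearMap.det T ≠ 0) {f : E m → F} (hf : Integrable f) :
    Integrable fun θ => f (T θ) := by
  have hemb := measurableEmbedding_of_det_ne_zero hT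
  have := hemb.integrable_map_iff (μ := volume) (g := f)
  rw [Measure.map_linearMap_addHaar_eq_smul_addHaar _ hT] at this
  exact this.mp (hf.smul_measure ENNReal.ofReal_ne_top)

/-- The integral of `e^{-2πi⟪w, φ⟫}` against the Gaussian weight `exp (-π²‖φ‖²/2)`. -/
theorem integral_gaussian_character {m : ℕ} (w : E m) :
    ∫ φ : E m, Complex.exp (-(2 * Real.pi * Complex.I * (inner ℝ w φ : ℝ))) *
        (Real.exp (-(Real.pi ^ 2 / 2) * ‖φ‖ ^ 2) : ℝ) =
      ((2 / Real.pi) ^ ((m : ℝ) / 2) * Real.exp (-2 * ‖w‖ ^ 2) : ℝ) := by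
  have hb : 0 < ((Real.pi ^ 2 / 2 : ℝ) : ℂ).re := by
    rw [Complex.ofReal_re]; positivity
  have hpi : (Real.pi : ℂ) ≠ 0 := by exact_mod_cast Real.pi_ne_zero
  have h := GaussianFourier.integral_cexp_neg_mul_sq_norm_add hb (-(2 * Real.pi * Complex.I)) w
  have h1 : ∀ φ : E m, Complex.exp (-(2 * Real.pi * Complex.I * (inner ℝ w φ : ℝ))) *
        (Real.exp (-(Real.pi ^ 2 / 2) * ‖φ‖ ^ 2) : ℝ) =
      Complex.exp (-((Real.pi ^ 2 / 2 : ℝ) : ℂ) * ‖φ‖ ^ 2 +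
        -(2 * Real.pi * Complex.I) * (inner ℝ w φ : ℝ)) := by
    intro φ
    rw [Complex.ofReal_exp, ← Complex.exp_add]
    congr 1
    push_cast
    ring
  simp_rw [h1]
  refine h.trans ?_
  rw [finrank_euclideanSpace_fin, Complex.ofReal_mul, Complex.ofReal_exp,
    Complex.ofReal_cpow (by positivity)]
  congr 2
  · push_cast
    field_simp
  · push_cast
    ring
  · push_cast
    rw [neg_sq, mul_pow, mul_pow, Complex.I_sq]
    field_simp
    ring

theorem integrable_norm_pow_mul_gaussian {m : ℕ} (hm : 0 < m) (k : ℕ) {b : ℝ} (hb : 0 < b) :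
    Integrable fun φ : E m => ‖φ‖ ^ k * Real.exp (-b * ‖φ‖ ^ 2) := by
  have : Nonempty (Fin m) := ⟨⟨0, hm⟩⟩
  refine (integrable_fun_norm_addHaar (E := E m) volume
    (f := fun y => y ^ k * Real.exp (-b * y ^ 2))).mpr ?_
  have := integrableOn_rpow_mul_exp_neg_mul_sq hb (s := ((m - 1 + k : ℕ) : ℝ))
    (by have : (0 : ℝ) ≤ ((m - 1 + k : ℕ) : ℝ) := by positivity
        linarith)
  refine this.congr_fun (fun y _ => ?_) measurableSet_Ioi
  simp only [smul_eq_mul]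
  rw [finrank_euclideanSpace_fin, Real.rpow_natCast, pow_add, mul_assoc]

/-- In polar coordinates: `E ‖φ‖⁴ = m (m + 2) / (4 b²)` for a Gaussian with weight
`exp (-b ‖φ‖²)`. -/
theorem integral_norm_pow_four_mul_gaussian {m : ℕ} (hm : 0 < m) {b : ℝ} (hb : 0 < b) :
    ∫ φ : E m, ‖φ‖ ^ 4 * Real.exp (-b * ‖φ‖ ^ 2) =
      (m * (m + 2) / (4 * b ^ 2)) * ∫ φ : E m, Real.exp (-b * ‖φ‖ ^ 2) := by
  have : Nonempty (Fin m) := ⟨⟨0, hm⟩⟩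
  have hm' : (0 : ℝ) < m := by exact_mod_cast hm
  have hpolar : ∀ k : ℕ, ∫ y in Set.Ioi (0 : ℝ), y ^ (m - 1) • (y ^ k * Real.exp (-b * y ^ 2)) =
      b ^ (-((m : ℝ) + k) / 2) * (1 / 2) * Real.Gamma (((m : ℝ) + k) / 2) := by
    intro k
    have h1 := integral_rpow_mul_exp_neg_mul_rpow (p := 2) (q := ((m - 1 + k : ℕ) : ℝ)) two_pos
      (by have : (0 : ℝ) ≤ ((m - 1 + k : ℕ) : ℝ) := by positivity
          linarith) hb
    have h2 : ((m - 1 + k : ℕ) : ℝ) + 1 = m + k := by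
      have : m - 1 + k + 1 = m + k := by omega
      exact_mod_cast this
    rw [h2] at h1
    rw [← h1]
    refine setIntegral_congr_fun measurableSet_Ioi fun y _ => ?_
    simp only [smul_eq_mul]
    rw [Real.rpow_natCast, pow_add, mul_assoc]
    norm_cast
  have hG : Real.Gamma (((m : ℝ) + (4 : ℕ)) / 2) =
      ((m : ℝ) / 2 + 1) * ((m : ℝ) / 2) * Real.Gamma (((m : ℝ) + (0 : ℕ)) / 2) := by
    rw [show ((m : ℝ) + (4 : ℕ)) / 2 = (m : ℝ) / 2 + 1 + 1 by push_cast; ring,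
      Real.Gamma_add_one (by positivity), Real.Gamma_add_one (by positivity)]
    simp [mul_assoc]
  have hbp : b ^ (-((m : ℝ) + (4 : ℕ)) / 2) = b ^ (-((m : ℝ) + (0 : ℕ)) / 2) / b ^ 2 := by
    rw [← Real.rpow_natCast b 2, ← Real.rpow_sub hb]
    congr 1
    push_cast
    ring
  have h4 := integral_fun_norm_addHaar (E := E m) volume
    (fun y => y ^ 4 * Real.exp (-b * y ^ 2))
  have h0 := integral_fun_norm_addHaar (E := E m) volume
    (fun y => y ^ 0 * Real.exp (-b * y ^ 2))
  rw [finrank_euclideanSpace_fin, hpolar] at h4 h0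
  simp only [pow_zero, one_mul] at h0
  rw [h4, h0, hG, hbp]
  simp only [nsmul_eq_mul, smul_eq_mul]
  field_simp
  ring

/-! ### Inequalities for the cosine -/

theorem cos_le_exp_neg_sq_div_two {x : ℝ} (hx : |x| ≤ Real.pi / 2) :
    Real.cos x ≤ Real.exp (-(x ^ 2 / 2)) := by
  wlog h0 : 0 ≤ x generalizing x
  · have := this (x := -x) (by rwa [abs_neg]) (by linarith)
    rwa [Real.cos_neg, neg_sq] at this
  rw [abs_of_nonneg h0] at hx
  -- `cos x * exp (x² / 2)` is antitone on `[0, π/2]` because `x ≤ tan x` there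
  have hanti : AntitoneOn (fun t => Real.cos t * Real.exp (t ^ 2 / 2))
      (Set.Icc 0 (Real.pi / 2)) := by
    have hder : ∀ t, HasDerivAt (fun t => Real.cos t * Real.exp (t ^ 2 / 2))
        (-Real.sin t * Real.exp (t ^ 2 / 2) + Real.cos t * (Real.exp (t ^ 2 / 2) * t)) t := by
      intro t
      have h1 : HasDerivAt (fun t : ℝ => t ^ 2 / 2) t t := by
        have := (hasDerivAt_pow 2 t).div_const 2
        simpa using this
      exact (Real.hasDerivAt_cos t).mul h1.exp
    refine antitoneOn_of_deriv_nonpos (convex_Icc _ _)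
      (fun t _ => (hder t).continuousAt.continuousWithinAt)
      (fun t _ => (hder t).differentiableAt.differentiableWithinAt) fun t ht => ?_
    rw [interior_Icc] at ht
    rw [(hder t).deriv]
    have hc : 0 < Real.cos t := Real.cos_pos_of_mem_Ioo ⟨by linarith [ht.1, Real.pi_pos], ht.2⟩
    have h2 := Real.le_tan ht.1.le ht.2
    rw [Real.tan_eq_sin_div_cos, le_div_iff₀ hc] at h2
    have h3 := mul_le_mul_of_nonneg_right h2 (Real.exp_pos (t ^ 2 / 2)).le
    linarith
  have h := hanti ⟨le_rfl, by positivity⟩ ⟨h0, hx⟩ h0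
  simp only [Real.cos_zero, one_mul] at h
  norm_num at h
  rw [Real.exp_neg, ← one_div, le_div_iff₀ (Real.exp_pos _)]
  exact h

theorem one_sub_cos_mul_exp_le {x : ℝ} (hx : |x| ≤ 1) :
    1 - Real.cos x * Real.exp (x ^ 2 / 2) ≤ x ^ 4 / 4 := by
  have h1 : x ^ 2 ≤ 1 := (sq_le_one_iff_abs_le_one x).mpr hx
  have h2 := Real.one_sub_sq_div_two_le_cos (x := x)
  have h3 := Real.add_one_le_exp (x ^ 2 / 2)
  have h4 : (1 - x ^ 2 / 2) * (x ^ 2 / 2 + 1) ≤ Real.cos x * Real.exp (x ^ 2 / 2) :=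
    mul_le_mul h2 h3 (by positivity) (by linarith)
  linarith [show (1 - x ^ 2 / 2) * (x ^ 2 / 2 + 1) = 1 - x ^ 4 / 4 by ring]

theorem one_sub_prod_le_sum_one_sub {ι : Type*} (s : Finset ι) {f : ι → ℝ}
    (h0 : ∀ i ∈ s, 0 ≤ f i) (h1 : ∀ i ∈ s, f i ≤ 1) :
    1 - ∏ i ∈ s, f i ≤ ∑ i ∈ s, (1 - f i) := by
  classical
  induction s using Finset.induction_on with
  | empty => simp
  | insert a s ha ih =>
    rw [Finset.prod_insert ha, Finset.sum_insert ha]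
    have ih' := ih (fun i hi => h0 i (Finset.mem_insert_of_mem hi))
      (fun i hi => h1 i (Finset.mem_insert_of_mem hi))
    have hp : ∏ i ∈ s, f i ≤ 1 := Finset.prod_le_one
      (fun i hi => h0 i (Finset.mem_insert_of_mem hi))
      (fun i hi => h1 i (Finset.mem_insert_of_mem hi))
    have ha1 := h1 a (Finset.mem_insert_self a s)
    nlinarith [mul_nonneg (sub_nonneg.mpr ha1) (sub_nonneg.mpr hp)]

/-- The pointwise comparison of the characteristic function `∏ cos xᵢ` with its Gaussian
approximation: the cubic terms vanish by symmetry, so the relative error is quartic. -/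
theorem abs_prod_cos_sub_exp_le {ι : Type*} [Fintype ι] {x : ι → ℝ} (hx : ∀ i, |x i| ≤ 1) :
    |∏ i, Real.cos (x i) - Real.exp (-(∑ i, x i ^ 2) / 2)| ≤
      (∑ i, x i ^ 4) / 4 * Real.exp (-(∑ i, x i ^ 2) / 2) := by
  have hexp : Real.exp (-(∑ i, x i ^ 2) / 2) = ∏ i, Real.exp (-(x i ^ 2 / 2)) := by
    rw [← Real.exp_sum, Finset.sum_neg_distrib, ← Finset.sum_div, neg_div]
  have hpi : ∀ i, |x i| ≤ Real.pi / 2 := fun i => (hx i).trans (by linarith [Real.pi_gt_three])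
  have hcos : ∀ i, 0 ≤ Real.cos (x i) := fun i =>
    Real.cos_nonneg_of_mem_Icc (abs_le.mp (hpi i))
  have hle : ∀ i, Real.cos (x i) ≤ Real.exp (-(x i ^ 2 / 2)) := fun i =>
    cos_le_exp_neg_sq_div_two (hpi i)
  have hcancel : ∀ i, Real.exp (x i ^ 2 / 2) * Real.exp (-(x i ^ 2 / 2)) = 1 := fun i => by
    rw [← Real.exp_add]; simp
  have hprod : ∏ i, Real.cos (x i) ≤ Real.exp (-(∑ i, x i ^ 2) / 2) := by
    rw [hexp]
    exact Finset.prod_le_prod (fun i _ => hcos i) fun i _ => hle i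
  rw [abs_sub_comm, abs_of_nonneg (sub_nonneg.mpr hprod)]
  have hfac : ∏ i, Real.cos (x i) =
      (∏ i, Real.cos (x i) * Real.exp (x i ^ 2 / 2)) * Real.exp (-(∑ i, x i ^ 2) / 2) := by
    rw [hexp, ← Finset.prod_mul_distrib]
    refine Finset.prod_congr rfl fun i _ => ?_
    rw [mul_assoc, hcancel, mul_one]
  have hbern := one_sub_prod_le_sum_one_sub (Finset.univ : Finset ι)
    (f := fun i => Real.cos (x i) * Real.exp (x i ^ 2 / 2))
    (fun i _ => mul_nonneg (hcos i) (Real.exp_pos _).le)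
    (fun i _ => by
      calc Real.cos (x i) * Real.exp (x i ^ 2 / 2)
          ≤ Real.exp (-(x i ^ 2 / 2)) * Real.exp (x i ^ 2 / 2) := by gcongr; exact hle i
        _ = 1 := by rw [mul_comm, hcancel])
  have hsum : ∑ i, (1 - Real.cos (x i) * Real.exp (x i ^ 2 / 2)) ≤ (∑ i, x i ^ 4) / 4 := by
    rw [Finset.sum_div]
    exact Finset.sum_le_sum fun i _ => one_sub_cos_mul_exp_le (hx i)
  calc Real.exp (-(∑ i, x i ^ 2) / 2) - ∏ i, Real.cos (x i)
      = (1 - ∏ i, Real.cos (x i) * Real.exp (x i ^ 2 / 2)) *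
          Real.exp (-(∑ i, x i ^ 2) / 2) := by
        conv_lhs => rw [hfac]
        ring
    _ ≤ _ := by gcongr; exact hbern.trans hsum

theorem abs_cos_pi_mul_le (t : ℝ) : |Real.cos (Real.pi * t)| ≤ 1 - 2 * centeredMod t ^ 2 := by
  obtain ⟨h1, h2⟩ := centeredMod_mem t
  have hper : |Real.cos (Real.pi * t)| = |Real.cos (Real.pi * centeredMod t)| := by
    rw [centeredMod, mul_sub, mul_comm Real.pi (⌈t - 1 / 2⌉ : ℝ), Real.cos_sub_int_mul_pi,
      abs_mul]
    simp
  have hpi := Real.pi_pos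
  have hnn : 0 ≤ Real.cos (Real.pi * centeredMod t) :=
    Real.cos_nonneg_of_mem_Icc ⟨by nlinarith, by nlinarith⟩
  rw [hper, abs_of_nonneg hnn]
  refine (Real.cos_le_one_sub_mul_cos_sq (x := Real.pi * centeredMod t) ?_).trans_eq ?_
  · rw [abs_le]; constructor <;> nlinarith
  · field_simp

/-! ### Fourier inversion -/

theorem card_halfCube (n : ℕ) : ((halfCube n).card : ℝ) = 2 ^ n := by
  classical
  have h : (1 / 2 : ℝ) ≠ -(1 / 2) := by norm_num
  rw [halfCube, Fintype.card_piFinset, Finset.prod_const, Finset.card_pair h]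
  simp

theorem mem_halfCube {n : ℕ} {y : Fin n → ℝ} :
    y ∈ halfCube n ↔ ∀ j, y j = 1 / 2 ∨ y j = -(1 / 2) := by
  simp [halfCube, Fintype.mem_piFinset]

theorem toLp_colMatrix_mulVec {m n : ℕ} (x : Fin n → E m) (y : Fin n → ℝ) :
    WithLp.toLp 2 ((colMatrix x).mulVec y) = ∑ j, y j • x j := by
  ext i
  simp [colMatrix, Matrix.mulVec, dotProduct, mul_comm]

/-- Summing `exp (2πi ⟨y, a⟩)` over the cube `{1/2, -1/2}^n` factors into cosines. -/
theorem sum_halfCube_exp {n : ℕ} (a : Fin n → ℝ) :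
    ∑ y ∈ halfCube n, Complex.exp (2 * Real.pi * Complex.I * (∑ j, y j * a j : ℝ)) =
      2 ^ n * ((∏ j, Real.cos (Real.pi * a j) : ℝ) : ℂ) := by
  classical
  have h : (1 / 2 : ℝ) ≠ -(1 / 2) := by norm_num
  have h1 : ∀ j, ∑ t ∈ ({1 / 2, -(1 / 2)} : Finset ℝ),
      Complex.exp (2 * Real.pi * Complex.I * (t * a j : ℝ)) =
      2 * (Real.cos (Real.pi * a j) : ℂ) := by
    intro j
    rw [Finset.sum_pair h, Complex.ofReal_cos, Complex.two_cos]
    congr 2 <;> push_cast <;> ring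
  have h2 := Finset.prod_univ_sum (fun _ : Fin n => ({1 / 2, -(1 / 2)} : Finset ℝ))
    (fun j t => Complex.exp (2 * Real.pi * Complex.I * (t * a j : ℝ)))
  simp_rw [h1] at h2
  rw [Finset.prod_mul_distrib, Finset.prod_const, Finset.card_univ, Fintype.card_fin] at h2
  rw [Complex.ofReal_prod, h2, halfCube]
  refine Finset.sum_congr (by congr) fun y _ => ?_
  rw [← Complex.exp_sum, Complex.ofReal_sum, Finset.mul_sum]

/-- **Fourier inversion** on the dual lattice. -/
theorem hitProb_eq_setIntegral {m n : ℕ} {𝓛 : Submodule ℤ (E m)} [DiscreteTopology 𝓛]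
    [IsZLattice ℝ 𝓛] {D : Set (E m)}
    (hD : IsAddFundamentalDomain (dualLattice 𝓛) D volume)
    (hvol : volume.real D = (ZLattice.covolume 𝓛)⁻¹) (htop : volume D ≠ ⊤)
    {x : Fin n → E m} (hx : ∀ j, x j ∈ 𝓛) {v : E m}
    (hv : v ∈ shiftedLattice 𝓛 (colMatrix x)) :
    (hitProb (colMatrix x) v : ℂ) = ZLattice.covolume 𝓛 *
      ∫ θ in D, Complex.exp (-(2 * Real.pi * Complex.I * (inner ℝ v θ : ℝ))) *
        ((∏ j, Real.cos (Real.pi * inner ℝ θ (x j)) : ℝ) : ℂ) := by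
  classical
  have hc := ZLattice.covolume_ne_zero 𝓛
  let u : (Fin n → ℝ) → E m := fun y => WithLp.toLp 2 ((colMatrix x).mulVec y) - v
  have hu : ∀ y ∈ halfCube n, u y ∈ 𝓛 := by
    intro y hy
    obtain ⟨w, hw, rfl⟩ := hv
    have h1 : u y = ∑ j, (y j + 1 / 2) • x j - w := by
      simp only [u, toLp_colMatrix_mulVec, Pi.one_apply, one_smul, add_smul, one_div]
      rw [Finset.sum_add_distrib, ← Finset.smul_sum]
      abel
    rw [h1]
    refine sub_mem (sum_mem fun j _ => ?_) hw
    rcases mem_halfCube.mp hy j with h | h <;> rw [h]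
    · norm_num [hx j]
    · norm_num
  have hu0 : ∀ y, u y = 0 ↔ (colMatrix x).mulVec y = v.ofLp := by
    intro y
    rw [sub_eq_zero]
    constructor
    · intro h; rw [← h]
    · intro h; rw [h]
  have hsum : ∀ θ, ∑ y ∈ halfCube n, Complex.exp (2 * Real.pi * Complex.I * (inner ℝ (u y) θ : ℝ))
      = 2 ^ n * (Complex.exp (-(2 * Real.pi * Complex.I * (inner ℝ v θ : ℝ))) *
        ((∏ j, Real.cos (Real.pi * inner ℝ θ (x j)) : ℝ) : ℂ)) := by
    intro θ
    rw [mul_left_comm, ← sum_halfCube_exp, Finset.mul_sum]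
    refine Finset.sum_congr rfl fun y _ => ?_
    rw [← Complex.exp_add]
    congr 1
    have : inner ℝ (u y) θ = ∑ j, y j * inner ℝ θ (x j) - inner ℝ v θ := by
      rw [inner_sub_left, toLp_colMatrix_mulVec, sum_inner]
      congr 1
      refine Finset.sum_congr rfl fun j _ => ?_
      rw [real_inner_smul_left, real_inner_comm]
    rw [this]
    push_cast
    ring
  have hint : ∀ y ∈ halfCube n, IntegrableOn
      (fun θ => Complex.exp (2 * Real.pi * Complex.I * (inner ℝ (u y) θ : ℝ))) D := by
    intro y _
    have hcont : Continuous
        (fun θ : E m => Complex.exp (2 * Real.pi * Complex.I * (inner ℝ (u y) θ : ℝ))) := by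
      fun_prop
    refine Measure.integrableOn_of_bounded htop hcont.aestronglyMeasurable (M := 1) ?_
    refine Filter.Eventually.of_forall fun θ => le_of_eq ?_
    rw [show 2 * (Real.pi : ℂ) * Complex.I * (inner ℝ (u y) θ : ℝ) =
      ((2 * Real.pi * inner ℝ (u y) θ : ℝ) : ℂ) * Complex.I by push_cast; ring,
      Complex.norm_exp_ofReal_mul_I]
  have htotal : 2 ^ n * ∫ θ in D, Complex.exp (-(2 * Real.pi * Complex.I * (inner ℝ v θ : ℝ))) *
        ((∏ j, Real.cos (Real.pi * inner ℝ θ (x j)) : ℝ) : ℂ) =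
      (((halfCube n).filter fun y => (colMatrix x).mulVec y = v.ofLp).card : ℂ) *
        (ZLattice.covolume 𝓛 : ℂ)⁻¹ := by
    rw [← integral_const_mul, ← integral_congr_ae (Filter.Eventually.of_forall hsum),
      integral_finsetSum _ hint, Finset.sum_congr rfl
        fun y hy => setIntegral_character hD (hu y hy)]
    simp_rw [hu0]
    rw [← Finset.sum_filter, Finset.sum_const, nsmul_eq_mul, hvol]
    push_cast
    rfl
  have hc' : (ZLattice.covolume 𝓛 : ℂ) ≠ 0 := by exact_mod_cast hc
  have h2n : (2 : ℂ) ^ n ≠ 0 := pow_ne_zero _ two_ne_zero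
  rw [hitProb, card_halfCube]
  rw [Complex.ofReal_div, Complex.ofReal_pow, Complex.ofReal_natCast, Complex.ofReal_ofNat,
    div_eq_iff h2n, mul_assoc, mul_comm _ ((2 : ℂ) ^ n), htotal, mul_left_comm,
    mul_inv_cancel₀ hc', mul_one]

/-! ### The local limit estimate for a fixed matrix -/

theorem dotProduct_mulVec_colMatrix {m n : ℕ} (x : Fin n → E m) (θ : E m) :
    θ.ofLp ⬝ᵥ (colMatrix x * (colMatrix x).transpose).mulVec θ.ofLp =
      ∑ j, inner ℝ θ (x j) ^ 2 := by
  rw [← Matrix.mulVec_mulVec, Matrix.dotProduct_mulVec, ← Matrix.mulVec_transpose]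
  simp [dotProduct, Matrix.mulVec, colMatrix, sq, PiLp.inner_apply, mul_comm]

theorem norm_sq_eq_dotProduct {m : ℕ} (θ : E m) : ‖θ‖ ^ 2 = θ.ofLp ⬝ᵥ θ.ofLp := by
  rw [EuclideanSpace.norm_sq_eq]
  simp [dotProduct, sq]

theorem integral_gaussian_comp_linearMap {m : ℕ} {T : E m →ₗ[ℝ] E m} (hT : LinearMap.det T ≠ 0)
    {b : ℝ} (hb : 0 < b) :
    ∫ θ, Real.exp (-b * ‖T θ‖ ^ 2) = |LinearMap.det T|⁻¹ * (Real.pi / b) ^ ((m : ℝ) / 2) := by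
  rw [integral_comp_linearMap hT (fun φ => Real.exp (-b * ‖φ‖ ^ 2)),
    GaussianFourier.integral_rexp_neg_mul_sq_norm hb, finrank_euclideanSpace_fin, smul_eq_mul]

theorem integrable_gaussian_comp_linearMap {m : ℕ} (hm : 0 < m) {T : E m →ₗ[ℝ] E m}
    (hT : LinearMap.det T ≠ 0) {b : ℝ} (hb : 0 < b) :
    Integrable fun θ => Real.exp (-b * ‖T θ‖ ^ 2) := by
  have := integrable_norm_pow_mul_gaussian (m := m) hm 0 hb
  simp only [pow_zero, one_mul] at this
  exact integrable_comp_linearMap hT this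

theorem posDef_of_sub_smul_one_posSemidef {m n : ℕ} (hn : 0 < n) {Q : Matrix (Fin m) (Fin m) ℝ}
    (hQ : (Q - ((n : ℝ) / 2) • (1 : Matrix (Fin m) (Fin m) ℝ)).PosSemidef) : Q.PosDef := by
  have h1 : (((n : ℝ) / 2) • (1 : Matrix (Fin m) (Fin m) ℝ)).PosDef :=
    Matrix.PosDef.one.smul (by positivity)
  simpa using h1.add_posSemidef hQ

theorem half_mul_norm_sq_le_of_posSemidef {m n : ℕ} {Q : Matrix (Fin m) (Fin m) ℝ}
    (hQ : (Q - ((n : ℝ) / 2) • (1 : Matrix (Fin m) (Fin m) ℝ)).PosSemidef) (θ : E m) :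
    (n : ℝ) / 2 * ‖θ‖ ^ 2 ≤ θ.ofLp ⬝ᵥ Q.mulVec θ.ofLp := by
  have h := hQ.dotProduct_mulVec_nonneg θ.ofLp
  rw [Matrix.sub_mulVec, Matrix.smul_mulVec, Matrix.one_mulVec, dotProduct_sub,
    dotProduct_smul, star_trivial, ← norm_sq_eq_dotProduct] at h
  simpa using h

theorem latticeGaussian_eq_integral {m n : ℕ} (𝓛 : Submodule ℤ (E m))
    {M : Matrix (Fin m) (Fin n) ℝ} {T : E m →ₗ[ℝ] E m} (hT : LinearMap.det T ≠ 0)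
    (hdet : |LinearMap.det T| = Real.sqrt (M * M.transpose).det) {v w : E m}
    (hw : ∀ θ, inner ℝ v θ = inner ℝ w (T θ))
    (hww : ‖w‖ ^ 2 = v.ofLp ⬝ᵥ (M * M.transpose)⁻¹.mulVec v.ofLp) :
    (latticeGaussian 𝓛 M v : ℂ) = ZLattice.covolume 𝓛 *
      ∫ θ, Complex.exp (-(2 * Real.pi * Complex.I * (inner ℝ v θ : ℝ))) *
        (Real.exp (-(Real.pi ^ 2 / 2) * ‖T θ‖ ^ 2) : ℝ) := by
  simp_rw [hw]
  rw [integral_comp_linearMap hT (fun φ =>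
    Complex.exp (-(2 * Real.pi * Complex.I * (inner ℝ w φ : ℝ))) *
      (Real.exp (-(Real.pi ^ 2 / 2) * ‖φ‖ ^ 2) : ℝ)), integral_gaussian_character,
    Complex.real_smul, ← Complex.ofReal_mul, ← Complex.ofReal_mul, latticeGaussian, gaussExp,
    ← hww, ← hdet, Real.div_rpow (by positivity) Real.pi_pos.le]
  congr 1
  have : |LinearMap.det T| ≠ 0 := abs_ne_zero.mpr hT
  have : Real.pi ^ ((m : ℝ) / 2) ≠ 0 := (Real.rpow_pos_of_pos Real.pi_pos _).ne'
  field_simp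

theorem latticeGaussian_eq_mul_gaussExp {m n : ℕ} (𝓛 : Submodule ℤ (E m))
    (M : Matrix (Fin m) (Fin n) ℝ) (v : E m) :
    latticeGaussian 𝓛 M v = latticeGaussian 𝓛 M 0 * gaussExp M v := by
  simp [latticeGaussian, gaussExp]

theorem latticeGaussian_zero_eq_integral {m n : ℕ} (𝓛 : Submodule ℤ (E m))
    {M : Matrix (Fin m) (Fin n) ℝ} {T : E m →ₗ[ℝ] E m} (hT : LinearMap.det T ≠ 0)
    (hdet : |LinearMap.det T| = Real.sqrt (M * M.transpose).det) :
    latticeGaussian 𝓛 M 0 = ZLattice.covolume 𝓛 *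
      ∫ θ, Real.exp (-(Real.pi ^ 2 / 2) * ‖T θ‖ ^ 2) := by
  have h := latticeGaussian_eq_integral 𝓛 hT hdet (v := 0) (w := 0) (by simp) (by simp)
  simp only [inner_zero_left, Complex.ofReal_zero, mul_zero, neg_zero, Complex.exp_zero,
    one_mul] at h
  rw [integral_complex_ofReal] at h
  exact_mod_cast h

/-- The crude bound `M Mᵀ ≤ n L² I` bounds the peak of the lattice Gaussian from below. -/
theorem le_latticeGaussian_zero {m n : ℕ} (hm : 0 < m) (hn : 0 < n) (𝓛 : Submodule ℤ (E m))
    [DiscreteTopology 𝓛] [IsZLattice ℝ 𝓛] {L : ℝ} (hL : 0 < L) {x : Fin n → E m}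
    (hxL : ∀ j, ‖x j‖ ≤ L)
    (hQ : (colMatrix x * (colMatrix x).transpose -
      ((n : ℝ) / 2) • (1 : Matrix (Fin m) (Fin m) ℝ)).PosSemidef) :
    ZLattice.covolume 𝓛 * (2 / (Real.pi * (n * L ^ 2))) ^ ((m : ℝ) / 2) ≤
      latticeGaussian 𝓛 (colMatrix x) 0 := by
  have hpd := posDef_of_sub_smul_one_posSemidef hn hQ
  obtain ⟨T, hdet, hTnorm, -⟩ := exists_linearMap_of_posDef hpd
  have hT : LinearMap.det T ≠ 0 := by
    rw [← abs_pos, hdet]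
    exact Real.sqrt_pos.mpr hpd.det_pos
  have hn' : (0 : ℝ) < n := by exact_mod_cast hn
  have hpi := Real.pi_pos
  rw [latticeGaussian_zero_eq_integral 𝓛 hT hdet]
  refine mul_le_mul_of_nonneg_left ?_ (ZLattice.covolume_pos 𝓛).le
  have hb : 0 < Real.pi ^ 2 / 2 * (n * L ^ 2) := by positivity
  have h0 := GaussianFourier.integral_rexp_neg_mul_sq_norm (V := E m) hb
  have hint := integrable_norm_pow_mul_gaussian (m := m) hm 0 hb
  simp only [pow_zero, one_mul] at hint
  rw [finrank_euclideanSpace_fin, show Real.pi / (Real.pi ^ 2 / 2 * (n * L ^ 2)) =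
    2 / (Real.pi * (n * L ^ 2)) by field_simp] at h0
  rw [← h0]
  refine integral_mono hint (integrable_gaussian_comp_linearMap hm hT (by positivity)) fun θ => ?_
  refine Real.exp_le_exp.mpr ?_
  have h1 : ‖T θ‖ ^ 2 ≤ n * L ^ 2 * ‖θ‖ ^ 2 := by
    rw [hTnorm, dotProduct_mulVec_colMatrix]
    calc ∑ j, inner ℝ θ (x j) ^ 2 ≤ ∑ _j : Fin n, (‖θ‖ * L) ^ 2 := by
          refine Finset.sum_le_sum fun j _ => ?_
          refine sq_le_sq.mpr ?_
          rw [abs_of_nonneg (mul_nonneg (norm_nonneg θ) hL.le)]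
          exact (abs_real_inner_le_norm _ _).trans (by gcongr; exact hxL j)
      _ = n * L ^ 2 * ‖θ‖ ^ 2 := by simp; ring
  have : 0 < Real.pi ^ 2 / 2 := by positivity
  nlinarith

/-- The deterministic part of the local limit theorem: the Fourier integral over a fundamental
domain `D` of the dual lattice is compared with the Gaussian integral over the whole space. The
three error terms come from the ball of radius `1 / (4L)`, from the Gaussian outside of that ball,
and from `D` outside of that ball. -/
theorem abs_hitProb_sub_latticeGaussian_le {m n : ℕ} (hm : 0 < m) (hn : 0 < n)
    {𝓛 : Submodule ℤ (E m)} [DiscreteTopology 𝓛] [IsZLattice ℝ 𝓛] {L : ℝ} (hL : 0 < L)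
    {D : Set (E m)} (hDmeas : MeasurableSet D) (hball : Metric.closedBall 0 (1 / (4 * L)) ⊆ D)
    (hD : IsAddFundamentalDomain (dualLattice 𝓛) D volume)
    (hvol : volume.real D = (ZLattice.covolume 𝓛)⁻¹) (htop : volume D ≠ ⊤)
    {x : Fin n → E m} (hx : ∀ j, x j ∈ 𝓛) (hxL : ∀ j, ‖x j‖ ≤ L)
    (hQ : (colMatrix x * (colMatrix x).transpose -
      ((n : ℝ) / 2) • (1 : Matrix (Fin m) (Fin m) ℝ)).PosSemidef)
    {v : E m} (hv : v ∈ shiftedLattice 𝓛 (colMatrix x)) :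
    |hitProb (colMatrix x) v - latticeGaussian 𝓛 (colMatrix x) v| ≤
      latticeGaussian 𝓛 (colMatrix x) 0 * (m * (m + 2) * L ^ 2 / (2 * n) +
        2 ^ ((m : ℝ) / 2) * Real.exp (-(Real.pi ^ 2 * n / (128 * L ^ 2)))) +
      ZLattice.covolume 𝓛 * ∫ θ in D \ Metric.closedBall 0 (1 / (4 * L)),
        ∏ j, |Real.cos (Real.pi * inner ℝ θ (x j))| := by
  set r := 1 / (4 * L) with hr
  set Bl : Set (E m) := Metric.closedBall 0 r with hBl
  have hn' : (0 : ℝ) < n := by exact_mod_cast hn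
  have hpi := Real.pi_pos
  have hc := ZLattice.covolume_pos 𝓛
  have hpd := posDef_of_sub_smul_one_posSemidef hn hQ
  obtain ⟨T, hdet, hTnorm, hTdual⟩ := exists_linearMap_of_posDef hpd
  have hT : LinearMap.det T ≠ 0 := by
    rw [← abs_pos, hdet]
    exact Real.sqrt_pos.mpr hpd.det_pos
  obtain ⟨w, hw, hww⟩ := hTdual v
  have hTcont : Continuous T := T.continuous_of_finiteDimensional
  have hTlow : ∀ θ, (n : ℝ) / 2 * ‖θ‖ ^ 2 ≤ ‖T θ‖ ^ 2 := fun θ => by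
    rw [hTnorm]; exact half_mul_norm_sq_le_of_posSemidef hQ θ
  have hTsum : ∀ θ, ‖T θ‖ ^ 2 = ∑ j, inner ℝ θ (x j) ^ 2 := fun θ => by
    rw [hTnorm, dotProduct_mulVec_colMatrix]
  let e : E m → ℂ := fun θ => Complex.exp (-(2 * Real.pi * Complex.I * (inner ℝ v θ : ℝ)))
  let p : E m → ℝ := fun θ => ∏ j, Real.cos (Real.pi * inner ℝ θ (x j))
  let g : E m → ℝ := fun θ => Real.exp (-(Real.pi ^ 2 / 2) * ‖T θ‖ ^ 2)
  have he : ∀ θ, ‖e θ‖ = 1 := by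
    intro θ
    change ‖Complex.exp _‖ = 1
    rw [show -(2 * (Real.pi : ℂ) * Complex.I * (inner ℝ v θ : ℝ)) =
      ((-(2 * Real.pi * inner ℝ v θ) : ℝ) : ℂ) * Complex.I by push_cast; ring,
      Complex.norm_exp_ofReal_mul_I]
  have hecont : Continuous e := by fun_prop
  have hpcont : Continuous p := by fun_prop
  have hgcont : Continuous g := by fun_prop
  have hg0 : ∀ θ, 0 ≤ g θ := fun θ => (Real.exp_pos _).le
  have hp1 : ∀ θ, ‖p θ‖ ≤ 1 := fun θ => by
    rw [Real.norm_eq_abs, Finset.abs_prod]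
    exact Finset.prod_le_one (fun _ _ => abs_nonneg _) fun _ _ => Real.abs_cos_le_one _
  have hgint : Integrable g := integrable_gaussian_comp_linearMap hm hT (by positivity)
  have hHint : Integrable fun θ => e θ * (g θ : ℂ) := by
    refine hgint.mono' (hecont.mul (Complex.continuous_ofReal.comp hgcont)).aestronglyMeasurable
      (Filter.Eventually.of_forall fun θ => ?_)
    rw [norm_mul, he, one_mul, Complex.norm_real, Real.norm_of_nonneg (hg0 θ)]
  have hFint : IntegrableOn (fun θ => e θ * (p θ : ℂ)) D := by
    refine Measure.integrableOn_of_bounded htop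
      (hecont.mul (Complex.continuous_ofReal.comp hpcont)).aestronglyMeasurable (M := 1)
      (Filter.Eventually.of_forall fun θ => ?_)
    rw [norm_mul, he, one_mul, Complex.norm_real]
    exact hp1 θ
  have hBmeas : MeasurableSet Bl := measurableSet_closedBall
  have hsplitF : ∫ θ in D, e θ * (p θ : ℂ) =
      (∫ θ in Bl, e θ * (p θ : ℂ)) + ∫ θ in D \ Bl, e θ * (p θ : ℂ) := by
    rw [← setIntegral_union Set.disjoint_sdiff_right (hDmeas.diff hBmeas)
      (hFint.mono_set hball) (hFint.mono_set Set.sdiff_subset), Set.union_sdiff_cancel hball]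
  have hsplitH : ∫ θ, e θ * (g θ : ℂ) =
      (∫ θ in Bl, e θ * (g θ : ℂ)) + ∫ θ in Blᶜ, e θ * (g θ : ℂ) :=
    (integral_add_compl hBmeas hHint).symm
  -- on the ball
  have hnear : ‖(∫ θ in Bl, e θ * (p θ : ℂ)) - ∫ θ in Bl, e θ * (g θ : ℂ)‖ ≤
      m * (m + 2) * L ^ 2 / (2 * n) * ∫ θ, g θ := by
    have h4 : Integrable fun θ => ‖T θ‖ ^ 4 * g θ :=
      integrable_comp_linearMap hT (integrable_norm_pow_mul_gaussian hm 4
        (b := Real.pi ^ 2 / 2) (by positivity))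
    have h4val : ∫ θ, ‖T θ‖ ^ 4 * g θ = m * (m + 2) / Real.pi ^ 4 * ∫ θ, g θ := by
      rw [integral_comp_linearMap hT (fun φ => ‖φ‖ ^ 4 * Real.exp (-(Real.pi ^ 2 / 2) * ‖φ‖ ^ 2)),
        integral_norm_pow_four_mul_gaussian hm (by positivity),
        integral_comp_linearMap hT (fun φ => Real.exp (-(Real.pi ^ 2 / 2) * ‖φ‖ ^ 2))]
      simp only [smul_eq_mul]
      field_simp
      ring
    rw [← integral_sub (hFint.mono_set hball) hHint.integrableOn]
    have hpt : ∀ θ ∈ Bl, ‖e θ * (p θ : ℂ) - e θ * (g θ : ℂ)‖ ≤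
        Real.pi ^ 4 * L ^ 2 / (2 * n) * (‖T θ‖ ^ 4 * g θ) := by
      intro θ hθ
      have hθ' : ‖θ‖ ≤ r := mem_closedBall_zero_iff.mp hθ
      have hinner : ∀ j, |inner ℝ θ (x j)| ≤ ‖θ‖ * L := fun j =>
        (abs_real_inner_le_norm _ _).trans (by gcongr; exact hxL j)
      have hle1 : ∀ j, |Real.pi * inner ℝ θ (x j)| ≤ 1 := fun j => by
        rw [abs_mul, abs_of_pos hpi]
        calc Real.pi * |inner ℝ θ (x j)| ≤ 4 * (r * L) := by
              refine mul_le_mul Real.pi_le_four ((hinner j).trans (by gcongr)) (abs_nonneg _)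
                (by norm_num)
          _ = 1 := by rw [hr]; field_simp
      have hmain := abs_prod_cos_sub_exp_le hle1
      have hgθ : Real.exp (-(∑ j, (Real.pi * inner ℝ θ (x j)) ^ 2) / 2) = g θ := by
        simp only [g, hTsum, mul_pow, ← Finset.mul_sum]
        congr 1
        ring
      have hfour : ∑ j, (Real.pi * inner ℝ θ (x j)) ^ 4 ≤
          Real.pi ^ 4 * (2 * L ^ 2 / n * ‖T θ‖ ^ 4) := by
        calc ∑ j, (Real.pi * inner ℝ θ (x j)) ^ 4
            ≤ ∑ j, Real.pi ^ 4 * ((‖θ‖ * L) ^ 2 * inner ℝ θ (x j) ^ 2) := by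
              refine Finset.sum_le_sum fun j _ => ?_
              rw [mul_pow, show inner ℝ θ (x j) ^ 4 =
                inner ℝ θ (x j) ^ 2 * inner ℝ θ (x j) ^ 2 by ring]
              have := sq_le_sq' (abs_le.mp (hinner j)).1 (abs_le.mp (hinner j)).2
              gcongr
          _ = Real.pi ^ 4 * (L ^ 2 * (‖θ‖ ^ 2) * ‖T θ‖ ^ 2) := by
              rw [← Finset.mul_sum, ← Finset.mul_sum, ← hTsum]; ring
          _ ≤ Real.pi ^ 4 * (L ^ 2 * (2 / n * ‖T θ‖ ^ 2) * ‖T θ‖ ^ 2) := by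
              have := hTlow θ
              have h2 : ‖θ‖ ^ 2 ≤ 2 / n * ‖T θ‖ ^ 2 := by
                rw [div_mul_eq_mul_div, le_div_iff₀ hn']; linarith
              gcongr
          _ = _ := by ring
      rw [hgθ] at hmain
      rw [← mul_sub, norm_mul, he, one_mul, ← Complex.ofReal_sub, Complex.norm_real,
        Real.norm_eq_abs]
      refine hmain.trans ?_
      calc (∑ j, (Real.pi * inner ℝ θ (x j)) ^ 4) / 4 * g θ
          ≤ Real.pi ^ 4 * (2 * L ^ 2 / n * ‖T θ‖ ^ 4) / 4 * g θ := by
            have := hg0 θ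
            gcongr
        _ = _ := by field_simp; ring
    calc ‖∫ θ in Bl, (e θ * (p θ : ℂ) - e θ * (g θ : ℂ))‖
        ≤ ∫ θ in Bl, Real.pi ^ 4 * L ^ 2 / (2 * n) * (‖T θ‖ ^ 4 * g θ) :=
          norm_integral_le_of_norm_le (h4.const_mul _).integrableOn
            ((ae_restrict_iff' hBmeas).mpr (Filter.Eventually.of_forall hpt))
      _ ≤ ∫ θ, Real.pi ^ 4 * L ^ 2 / (2 * n) * (‖T θ‖ ^ 4 * g θ) :=
          setIntegral_le_integral (h4.const_mul _)
            (Filter.Eventually.of_forall fun θ => by have := hg0 θ; positivity)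
      _ = _ := by
          rw [integral_const_mul, h4val]
          field_simp
  -- the Gaussian outside of the ball
  have htail : ‖∫ θ in Blᶜ, e θ * (g θ : ℂ)‖ ≤
      2 ^ ((m : ℝ) / 2) * Real.exp (-(Real.pi ^ 2 * n / (128 * L ^ 2))) * ∫ θ, g θ := by
    let g' : E m → ℝ := fun θ => Real.exp (-(Real.pi ^ 2 / 4) * ‖T θ‖ ^ 2)
    have hg'int : Integrable g' := integrable_gaussian_comp_linearMap hm hT (by positivity)
    have hg'val : ∫ θ, g' θ = 2 ^ ((m : ℝ) / 2) * ∫ θ, g θ := by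
      have h1 := integral_gaussian_comp_linearMap hT (b := Real.pi ^ 2 / 4) (by positivity)
      have h2 := integral_gaussian_comp_linearMap hT (b := Real.pi ^ 2 / 2) (by positivity)
      rw [show Real.pi / (Real.pi ^ 2 / 4) = 2 * (Real.pi / (Real.pi ^ 2 / 2)) by
        field_simp; norm_num, Real.mul_rpow (by norm_num) (by positivity)] at h1
      simp only [g', g, h1, h2]
      ring
    have hpt : ∀ θ ∈ Blᶜ, ‖e θ * (g θ : ℂ)‖ ≤
        Real.exp (-(Real.pi ^ 2 * n / (128 * L ^ 2))) * g' θ := by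
      intro θ hθ
      have hθ' : r ≤ ‖θ‖ := by
        by_contra! h
        exact hθ (mem_closedBall_zero_iff.mpr h.le)
      rw [norm_mul, he, one_mul, Complex.norm_real, Real.norm_of_nonneg (hg0 θ)]
      simp only [g, g']
      rw [← Real.exp_add]
      refine Real.exp_le_exp.mpr ?_
      have h1 : (n : ℝ) / 2 * r ^ 2 ≤ ‖T θ‖ ^ 2 := by
        refine le_trans ?_ (hTlow θ)
        gcongr
      have h2 : Real.pi ^ 2 * n / (128 * L ^ 2) = Real.pi ^ 2 / 4 * ((n : ℝ) / 2 * r ^ 2) := by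
        rw [hr]; field_simp; norm_num
      rw [h2]
      have : 0 < Real.pi ^ 2 / 4 := by positivity
      nlinarith
    calc ‖∫ θ in Blᶜ, e θ * (g θ : ℂ)‖
        ≤ ∫ θ in Blᶜ, Real.exp (-(Real.pi ^ 2 * n / (128 * L ^ 2))) * g' θ :=
          norm_integral_le_of_norm_le (hg'int.const_mul _).integrableOn
            ((ae_restrict_iff' hBmeas.compl).mpr (Filter.Eventually.of_forall hpt))
      _ ≤ ∫ θ, Real.exp (-(Real.pi ^ 2 * n / (128 * L ^ 2))) * g' θ :=
          setIntegral_le_integral (hg'int.const_mul _)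
            (Filter.Eventually.of_forall fun θ => by positivity)
      _ = _ := by
          rw [integral_const_mul, hg'val]
          ring
  -- the fundamental domain outside of the ball
  have hfar : ‖∫ θ in D \ Bl, e θ * (p θ : ℂ)‖ ≤
      ∫ θ in D \ Bl, ∏ j, |Real.cos (Real.pi * inner ℝ θ (x j))| := by
    refine (norm_integral_le_integral_norm _).trans_eq (integral_congr_ae
      (Filter.Eventually.of_forall fun θ => ?_))
    simp only
    rw [norm_mul, he, one_mul, Complex.norm_real, Real.norm_eq_abs, Finset.abs_prod]
  have hF := hitProb_eq_setIntegral hD hvol htop hx hv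
  have hG := latticeGaussian_eq_integral 𝓛 hT hdet hw hww
  rw [latticeGaussian_zero_eq_integral 𝓛 hT hdet, ← Real.norm_eq_abs, ← Complex.norm_real,
    Complex.ofReal_sub, hF, hG, ← mul_sub, norm_mul, Complex.norm_real, Real.norm_of_nonneg hc.le,
    mul_assoc (ZLattice.covolume 𝓛 volume), ← mul_add]
  refine mul_le_mul_of_nonneg_left ?_ hc.le
  change ‖(∫ θ in D, e θ * (p θ : ℂ)) - ∫ θ, e θ * (g θ : ℂ)‖ ≤ _
  rw [hsplitF, hsplitH]
  have htri : ‖(∫ θ in Bl, e θ * (p θ : ℂ)) + (∫ θ in D \ Bl, e θ * (p θ : ℂ)) -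
      ((∫ θ in Bl, e θ * (g θ : ℂ)) + ∫ θ in Blᶜ, e θ * (g θ : ℂ))‖ ≤
      ‖(∫ θ in Bl, e θ * (p θ : ℂ)) - ∫ θ in Bl, e θ * (g θ : ℂ)‖ +
      ‖∫ θ in D \ Bl, e θ * (p θ : ℂ)‖ + ‖∫ θ in Blᶜ, e θ * (g θ : ℂ)‖ := by
    rw [show ∀ a b c d : ℂ, a + b - (c + d) = (a - c) + b - d by intros; ring]
    exact (norm_sub_le _ _).trans (by gcongr; exact norm_add_le _ _)
  refine htri.trans ?_
  change _ ≤ (∫ θ, g θ) * _ + _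
  linarith

/-! ### Isotropic distributions on a lattice -/

theorem ae_norm_le_of_support_subset {m : ℕ} {μ : Measure (E m)} {L : ℝ}
    (hsupp : μ.support ⊆ Metric.closedBall 0 L) : ∀ᵐ x ∂μ, ‖x‖ ≤ L := by
  filter_upwards [Measure.support_mem_ae (μ := μ)] with x hx
  exact mem_closedBall_zero_iff.mp (hsupp hx)

theorem abs_coord_le_norm {m : ℕ} (x : E m) (i : Fin m) : |x i| ≤ ‖x‖ := by
  simpa using PiLp.norm_apply_le x i

theorem memLp_coord_mul_coord {m : ℕ} {μ : Measure (E m)} [IsProbabilityMeasure μ] {L : ℝ}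
    (hbd : ∀ᵐ x ∂μ, ‖x‖ ≤ L) (i k : Fin m) (p : ℝ≥0∞) :
    MemLp (fun x : E m => x i * x k) p μ := by
  have hc : Continuous fun x : E m => x i * x k := by fun_prop
  refine MemLp.of_bound hc.aestronglyMeasurable (L * L) ?_
  filter_upwards [hbd] with x hx
  rw [Real.norm_eq_abs, abs_mul]
  exact mul_le_mul ((abs_coord_le_norm x i).trans hx) ((abs_coord_le_norm x k).trans hx)
    (abs_nonneg _) ((norm_nonneg x).trans hx)

theorem integral_coord_mul_coord {m : ℕ} {μ : Measure (E m)} (hsm : secondMoment μ = 1)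
    (i k : Fin m) : ∫ x, x i * x k ∂μ = (1 : Matrix (Fin m) (Fin m) ℝ) i k := by
  rw [← hsm]; rfl

/-- Isotropy: the second moment of every linear functional is its squared norm. -/
theorem integral_inner_sq {m : ℕ} {μ : Measure (E m)} [IsProbabilityMeasure μ] {L : ℝ}
    (hbd : ∀ᵐ x ∂μ, ‖x‖ ≤ L) (hsm : secondMoment μ = 1) (v : E m) :
    ∫ x, inner ℝ v x ^ 2 ∂μ = ‖v‖ ^ 2 := by
  have h1 : ∀ x : E m, inner ℝ v x ^ 2 = ∑ i, ∑ k, v i * v k * (x i * x k) := by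
    intro x
    rw [sq, PiLp.inner_apply, Finset.sum_mul_sum]
    refine Finset.sum_congr rfl fun i _ => Finset.sum_congr rfl fun k _ => ?_
    simp only [RCLike.inner_apply, conj_trivial]
    ring
  have hint : ∀ i k, Integrable (fun x : E m => v i * v k * (x i * x k)) μ := fun i k =>
    ((memLp_coord_mul_coord hbd i k 1).integrable le_rfl).const_mul _
  simp_rw [h1]
  rw [integral_finsetSum _ fun i _ => integrable_finsetSum _ fun k _ => hint i k]
  simp_rw [integral_finsetSum _ fun k _ => hint _ k, integral_const_mul,
    integral_coord_mul_coord hsm, Matrix.one_apply]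
  rw [EuclideanSpace.norm_sq_eq]
  simp [sq]

theorem integral_norm_sq {m : ℕ} {μ : Measure (E m)} [IsProbabilityMeasure μ] {L : ℝ}
    (hbd : ∀ᵐ x ∂μ, ‖x‖ ≤ L) (hsm : secondMoment μ = 1) : ∫ x, ‖x‖ ^ 2 ∂μ = m := by
  have h1 : ∀ x : E m, ‖x‖ ^ 2 = ∑ i, x i * x i := by
    intro x
    rw [EuclideanSpace.norm_sq_eq]
    simp [sq]
  simp_rw [h1]
  rw [integral_finsetSum _ fun i _ => (memLp_coord_mul_coord hbd i i 1).integrable le_rfl]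
  simp [integral_coord_mul_coord hsm]

theorem nat_le_sq_of_isotropic {m : ℕ} {μ : Measure (E m)} [IsProbabilityMeasure μ] {L : ℝ}
    (hbd : ∀ᵐ x ∂μ, ‖x‖ ≤ L) (hsm : secondMoment μ = 1) : (m : ℝ) ≤ L ^ 2 := by
  rw [← integral_norm_sq hbd hsm]
  calc ∫ x, ‖x‖ ^ 2 ∂μ ≤ ∫ _x, L ^ 2 ∂μ := by
        refine integral_mono_of_nonneg (Filter.Eventually.of_forall fun x => by positivity)
          (integrable_const _) ?_
        filter_upwards [hbd] with x hx
        gcongr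
    _ = L ^ 2 := by simp

/-- A vector orthogonal to almost every sample of an isotropic distribution is zero. -/
theorem eq_zero_of_ae_inner_eq_zero {m : ℕ} {μ : Measure (E m)} [IsProbabilityMeasure μ] {L : ℝ}
    (hbd : ∀ᵐ x ∂μ, ‖x‖ ≤ L) (hsm : secondMoment μ = 1) {v : E m}
    (hv : ∀ᵐ x ∂μ, inner ℝ v x = 0) : v = 0 := by
  have h := integral_inner_sq hbd hsm v
  rw [integral_eq_zero_of_ae (by filter_upwards [hv] with x hx; simp [hx])] at h
  exact norm_eq_zero.mp (pow_eq_zero_iff two_ne_zero |>.mp h.symm)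

theorem isZLattice_of_isotropic {m : ℕ} {𝓛 : Submodule ℤ (E m)} {μ : Measure (E m)}
    [DiscreteTopology 𝓛] [IsProbabilityMeasure μ] {L : ℝ} (hbd : ∀ᵐ x ∂μ, ‖x‖ ≤ L)
    (hmem : ∀ᵐ x ∂μ, x ∈ 𝓛) (hsm : secondMoment μ = 1) : IsZLattice ℝ 𝓛 := by
  refine ⟨?_⟩
  rw [← Submodule.orthogonal_eq_bot_iff, Submodule.eq_bot_iff]
  intro v hv
  refine eq_zero_of_ae_inner_eq_zero hbd hsm ?_
  filter_upwards [hmem] with x hx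
  exact (Submodule.mem_orthogonal' _ v).mp hv x (Submodule.subset_span hx)

/-- Nonzero dual vectors have length at least `1 / L`: a shorter one would have an integral inner
product of absolute value less than `1`, hence zero, with almost every sample. -/
theorem one_div_le_norm_of_mem_dualLattice {m : ℕ} {𝓛 : Submodule ℤ (E m)} {μ : Measure (E m)}
    [IsProbabilityMeasure μ] {L : ℝ} (hL : 0 < L) (hbd : ∀ᵐ x ∂μ, ‖x‖ ≤ L)
    (hmem : ∀ᵐ x ∂μ, x ∈ 𝓛) (hsm : secondMoment μ = 1) {z : E m} (hz : z ∈ dualLattice 𝓛)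
    (hz0 : z ≠ 0) : 1 / L ≤ ‖z‖ := by
  by_contra! h
  refine hz0 (eq_zero_of_ae_inner_eq_zero hbd hsm ?_)
  filter_upwards [hbd, hmem] with x hxL hx
  obtain ⟨k, hk⟩ := (mem_dualLattice 𝓛 z).mp hz x hx
  have h1 : |(k : ℝ)| < 1 := by
    rw [← hk]
    calc |inner ℝ z x| ≤ ‖z‖ * ‖x‖ := abs_real_inner_le_norm _ _
      _ ≤ ‖z‖ * L := by gcongr
      _ < 1 / L * L := by gcongr
      _ = 1 := by field_simp
  rw [hk]
  have h2 : |k| < 1 := by exact_mod_cast h1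
  exact_mod_cast Int.abs_lt_one_iff.mp h2

/-! ### The smallest eigenvalue of `M Mᵀ` -/

/-- A symmetric matrix at Frobenius distance at most `n / 2` from `n I` is at least `(n / 2) I`. -/
theorem posSemidef_of_frobenius_le {m n : ℕ} {Q : Matrix (Fin m) (Fin m) ℝ} (hsymm : Q.IsHermitian)
    (hQ : ∑ i, ∑ k, (Q i k - n * (1 : Matrix (Fin m) (Fin m) ℝ) i k) ^ 2 ≤ ((n : ℝ) / 2) ^ 2) :
    (Q - ((n : ℝ) / 2) • (1 : Matrix (Fin m) (Fin m) ℝ)).PosSemidef := by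
  refine Matrix.PosSemidef.of_dotProduct_mulVec_nonneg ?_ fun u => ?_
  · exact hsymm.sub (Matrix.isHermitian_one.smul (by rw [isSelfAdjoint_iff, star_trivial]))
  set A : Matrix (Fin m) (Fin m) ℝ := Q - (n : ℝ) • 1 with hA
  have hdecomp : Q - ((n : ℝ) / 2) • (1 : Matrix (Fin m) (Fin m) ℝ) = A + ((n : ℝ) / 2) • 1 := by
    rw [hA]
    ext i k
    simp
    ring
  have hquad : u ⬝ᵥ A.mulVec u = ∑ p : Fin m × Fin m, A p.1 p.2 * (u p.1 * u p.2) := by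
    rw [Fintype.sum_prod_type]
    simp only [dotProduct, Matrix.mulVec, Finset.mul_sum]
    refine Finset.sum_congr rfl fun i _ => Finset.sum_congr rfl fun k _ => by ring
  have huu : ∑ p : Fin m × Fin m, (u p.1 * u p.2) ^ 2 = (u ⬝ᵥ u) ^ 2 := by
    rw [Fintype.sum_prod_type, sq (u ⬝ᵥ u), dotProduct, Finset.sum_mul_sum]
    refine Finset.sum_congr rfl fun i _ => Finset.sum_congr rfl fun k _ => by ring
  have hAF : ∑ p : Fin m × Fin m, A p.1 p.2 ^ 2 ≤ ((n : ℝ) / 2) ^ 2 := by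
    rw [Fintype.sum_prod_type]
    simpa [hA] using hQ
  have hcs := Finset.sum_mul_sq_le_sq_mul_sq Finset.univ
    (fun p : Fin m × Fin m => A p.1 p.2) (fun p => u p.1 * u p.2)
  rw [← hquad, huu] at hcs
  have huu0 : 0 ≤ u ⬝ᵥ u := by
    simp only [dotProduct]
    exact Finset.sum_nonneg fun i _ => mul_self_nonneg _
  have hsq : (u ⬝ᵥ A.mulVec u) ^ 2 ≤ ((n : ℝ) / 2 * (u ⬝ᵥ u)) ^ 2 := by
    rw [mul_pow]
    exact hcs.trans (by gcongr)
  have habs := abs_le_of_sq_le_sq' hsq (by positivity)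
  rw [hdecomp, Matrix.add_mulVec, Matrix.smul_mulVec, Matrix.one_mulVec, dotProduct_add,
    dotProduct_smul, star_trivial, smul_eq_mul]
  linarith [habs.1]

open ProbabilityTheory in
/-- `M Mᵀ ≥ (n / 2) I` fails with probability at most `4 m L² / n`: the squared Frobenius norm
of `M Mᵀ - n I` has mean at most `n 𝔼 ‖X‖⁴ ≤ n m L²`, since its entries are sums of `n`
independent centred variables. -/
theorem measure_frobenius_le {m n : ℕ} (hn : 0 < n) {μ : Measure (E m)} [IsProbabilityMeasure μ]
    {L : ℝ} (hbd : ∀ᵐ x ∂μ, ‖x‖ ≤ L) (hsm : secondMoment μ = 1) :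
    (Measure.pi fun _ : Fin n => μ).real
      {x | ((n : ℝ) / 2) ^ 2 ≤ ∑ i, ∑ k, ((colMatrix x * (colMatrix x).transpose) i k -
        n * (1 : Matrix (Fin m) (Fin m) ℝ) i k) ^ 2} ≤ 4 * (m * L ^ 2) / n := by
  have hn' : (0 : ℝ) < n := by exact_mod_cast hn
  let P := Measure.pi fun _ : Fin n => μ
  let S : Fin m → Fin m → (Fin n → E m) → ℝ := fun i k => ∑ j, fun x => x j i * x j k
  have hS : ∀ i k (x : Fin n → E m), (colMatrix x * (colMatrix x).transpose) i k = S i k x := by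
    intro i k x
    simp [S, Matrix.mul_apply, colMatrix]
  have hmemLp := fun i k => memLp_coord_mul_coord (μ := μ) hbd i k 2
  have hSmem : ∀ i k, MemLp (S i k) 2 P := fun i k =>
    memLp_finsetSum' _ fun j _ => (hmemLp i k).comp_measurePreserving
      (measurePreserving_eval (fun _ : Fin n => μ) j)
  have hSmean : ∀ i k, P[S i k] = n * (1 : Matrix (Fin m) (Fin m) ℝ) i k := by
    intro i k
    have : ∀ j : Fin n, ∫ x, x j i * x j k ∂P = (1 : Matrix (Fin m) (Fin m) ℝ) i k := by
      intro j
      rw [← integral_coord_mul_coord hsm]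
      have hj := measurePreserving_eval (fun _ : Fin n => μ) j
      have h := integral_map (f := fun x : E m => x i * x k) hj.aemeasurable
        (by rw [hj.map_eq]; exact (hmemLp i k).aestronglyMeasurable)
      rw [hj.map_eq] at h
      exact h.symm
    simp only [S, Finset.sum_apply]
    rw [integral_finsetSum _ fun j _ => ?_]
    · simp [this]
    · exact ((memLp_coord_mul_coord (μ := μ) hbd i k 1).comp_measurePreserving
        (measurePreserving_eval (fun _ : Fin n => μ) j)).integrable le_rfl
  have hSvar : ∀ i k, ∫ x, (S i k x - n * (1 : Matrix (Fin m) (Fin m) ℝ) i k) ^ 2 ∂P ≤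
      n * ∫ x, (x i * x k) ^ 2 ∂μ := by
    intro i k
    rw [← hSmean i k, ← variance_eq_integral (hSmem i k).aemeasurable]
    have := variance_sum_pi (μ := fun _ : Fin n => μ) (X := fun _ x => x i * x k)
      fun j => hmemLp i k
    refine (this.trans_le ?_)
    rw [Finset.sum_const, Finset.card_univ, Fintype.card_fin, nsmul_eq_mul]
    exact mul_le_mul_of_nonneg_left
      (variance_le_expectation_sq (hmemLp i k).aestronglyMeasurable) hn'.le
  have hint : ∀ i k, Integrable
      (fun x => (S i k x - n * (1 : Matrix (Fin m) (Fin m) ℝ) i k) ^ 2) P := fun i k =>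
    ((hSmem i k).sub (memLp_const _)).integrable_sq
  have hintsum : Integrable (fun x => ∑ i, ∑ k,
      (S i k x - n * (1 : Matrix (Fin m) (Fin m) ℝ) i k) ^ 2) P :=
    integrable_finsetSum _ fun i _ => integrable_finsetSum _ fun k _ => hint i k
  have hmean : ∫ x, ∑ i, ∑ k, (S i k x - n * (1 : Matrix (Fin m) (Fin m) ℝ) i k) ^ 2 ∂P ≤
      n * (m * L ^ 2) := by
    rw [integral_finsetSum _ fun i _ => integrable_finsetSum _ fun k _ => hint i k]
    simp_rw [integral_finsetSum _ fun k _ => hint _ k]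
    calc ∑ i, ∑ k, ∫ x, (S i k x - n * (1 : Matrix (Fin m) (Fin m) ℝ) i k) ^ 2 ∂P
        ≤ ∑ i, ∑ k, n * ∫ x, (x i * x k) ^ 2 ∂μ :=
          Finset.sum_le_sum fun i _ => Finset.sum_le_sum fun k _ => hSvar i k
      _ = n * ∫ x, ∑ i, ∑ k, (x i * x k) ^ 2 ∂μ := by
          rw [integral_finsetSum _ fun i _ => integrable_finsetSum _
            fun k _ => (hmemLp i k).integrable_sq]
          simp_rw [integral_finsetSum _ fun k _ => (hmemLp _ k).integrable_sq, Finset.mul_sum]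
      _ ≤ n * ∫ x, L ^ 2 * ‖x‖ ^ 2 ∂μ := by
          have hbd2 : ∀ᵐ x ∂μ, ∑ i, ∑ k, (x i * x k) ^ 2 ≤ L ^ 2 * ‖x‖ ^ 2 := by
            filter_upwards [hbd] with x hx
            calc ∑ i, ∑ k, (x i * x k) ^ 2 = ‖x‖ ^ 2 * ‖x‖ ^ 2 := by
                  rw [EuclideanSpace.norm_sq_eq, Finset.sum_mul_sum]
                  simp [mul_pow]
              _ ≤ L ^ 2 * ‖x‖ ^ 2 := by gcongr
          have hc : Continuous fun x : E m => L ^ 2 * ‖x‖ ^ 2 := by fun_prop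
          refine mul_le_mul_of_nonneg_left (integral_mono_of_nonneg
            (Filter.Eventually.of_forall fun x => by positivity) ?_ hbd2) hn'.le
          refine Integrable.of_bound hc.aestronglyMeasurable (L ^ 2 * L ^ 2) ?_
          filter_upwards [hbd] with x hx
          rw [Real.norm_of_nonneg (by positivity)]
          gcongr
      _ = n * (m * L ^ 2) := by
          rw [integral_const_mul, integral_norm_sq hbd hsm]; ring
  simp_rw [hS]
  have hmk := mul_meas_ge_le_integral_of_nonneg
    (Filter.Eventually.of_forall fun x => Finset.sum_nonneg fun i _ => Finset.sum_nonneg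
      fun k _ => sq_nonneg (S i k x - n * (1 : Matrix (Fin m) (Fin m) ℝ) i k)) hintsum
    (((n : ℝ) / 2) ^ 2)
  rw [le_div_iff₀ hn']
  have h2 := hmk.trans hmean
  change P.real _ * _ ≤ _
  have h3 : (n : ℝ) * (P.real {x | ((n : ℝ) / 2) ^ 2 ≤ ∑ i, ∑ k,
      (S i k x - n * (1 : Matrix (Fin m) (Fin m) ℝ) i k) ^ 2} * n) ≤ n * (4 * (m * L ^ 2)) := by
    linarith
  exact le_of_mul_le_mul_left h3 hn'

/-! ### The Fourier integral far from the dual lattice -/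

theorem measurable_centeredMod : Measurable centeredMod := by
  unfold centeredMod
  fun_prop

theorem centeredMod_sq_le_one (y : ℝ) : centeredMod y ^ 2 ≤ 1 := by
  obtain ⟨h1, h2⟩ := centeredMod_mem y
  nlinarith

theorem tilde_sq {m : ℕ} (μ : Measure (E m)) (θ : E m) :
    tilde μ θ ^ 2 = ∫ x, centeredMod (inner ℝ θ x) ^ 2 ∂μ := by
  rw [tilde, Real.sq_sqrt (integral_nonneg fun x => by positivity)]
  simp_rw [sq_abs]

theorem integral_abs_cos_le {m : ℕ} (μ : Measure (E m)) [IsProbabilityMeasure μ] (θ : E m) :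
    ∫ x, |Real.cos (Real.pi * inner ℝ θ x)| ∂μ ≤ Real.exp (-2 * tilde μ θ ^ 2) := by
  have hmeas : Measurable fun x : E m => centeredMod (inner ℝ θ x) ^ 2 :=
    (measurable_centeredMod.comp (by fun_prop)).pow_const 2
  have hint : Integrable (fun x : E m => centeredMod (inner ℝ θ x) ^ 2) μ := by
    refine Integrable.of_bound hmeas.aestronglyMeasurable 1 (Filter.Eventually.of_forall fun x => ?_)
    rw [Real.norm_of_nonneg (sq_nonneg _)]
    exact centeredMod_sq_le_one _
  calc ∫ x, |Real.cos (Real.pi * inner ℝ θ x)| ∂μ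
      ≤ ∫ x, (1 - 2 * centeredMod (inner ℝ θ x) ^ 2) ∂μ :=
        integral_mono_of_nonneg (Filter.Eventually.of_forall fun x => abs_nonneg _)
          ((integrable_const _).sub (hint.const_mul 2))
          (Filter.Eventually.of_forall fun x => abs_cos_pi_mul_le _)
    _ = -2 * tilde μ θ ^ 2 + 1 := by
        rw [integral_sub (integrable_const _) (hint.const_mul 2), integral_const_mul, tilde_sq]
        simp
        ring
    _ ≤ _ := Real.add_one_le_exp _

/-- Away from the dual lattice, `X̃` is bounded below: by the spanningness at pseudodual points, and
by half of the distance at all others. -/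
theorem le_tilde_of_le_spanningness {m : ℕ} {μ : Measure (E m)} {𝓛 : Submodule ℤ (E m)} {a r : ℝ}
    (hr : 0 < r) (har : a ≤ r / 2) (has : ENNReal.ofReal a ≤ spanningness μ 𝓛) {θ : E m}
    (hθ : ∀ z ∈ dualLattice 𝓛, r < dist θ z) : a ≤ tilde μ θ := by
  have h0 : 0 ≤ tilde μ θ := Real.sqrt_nonneg _
  by_cases hps : IsPseudodual μ 𝓛 θ
  · have hnot : θ ∉ dualLattice 𝓛 := fun h => by
      have := hθ θ h
      rw [dist_self] at this
      linarith
    have h1 : spanningness μ 𝓛 ≤ ENNReal.ofReal (tilde μ θ) :=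
      iInf_le_of_le θ (iInf_le_of_le hnot (iInf_le _ hps))
    exact (ENNReal.ofReal_le_ofReal_iff h0).mp (has.trans h1)
  · rw [IsPseudodual, not_le] at hps
    have h2 : r ≤ Metric.infDist θ (dualLattice 𝓛 : Set (E m)) :=
      (Metric.le_infDist ⟨0, zero_mem _⟩).mpr fun z hz => (hθ z hz).le
    linarith

/-- The mean, over the random columns, of the Fourier integral over a region on which `X̃ ≥ a`
is at most `exp (-2 n a²)` times the volume; Markov's inequality turns this into a tail bound. -/
theorem measure_setIntegral_prod_abs_cos_le {m n : ℕ} (μ : Measure (E m))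
    [IsProbabilityMeasure μ] {A : Set (E m)} (hA : MeasurableSet A) (hAtop : volume A ≠ ⊤)
    {a δ : ℝ} (ha : 0 ≤ a) (hδ : 0 < δ) (htilde : ∀ θ ∈ A, a ≤ tilde μ θ) :
    (Measure.pi fun _ : Fin n => μ).real
      {x | δ ≤ ∫ θ in A, ∏ j, |Real.cos (Real.pi * inner ℝ θ (x j))|} ≤
      Real.exp (-2 * (n * a ^ 2)) * volume.real A / δ := by
  let P := Measure.pi fun _ : Fin n => μ
  have : IsFiniteMeasure (volume.restrict A) := ⟨by simpa using hAtop.lt_top⟩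
  have hcont : Continuous fun q : (Fin n → E m) × E m =>
      ∏ j, |Real.cos (Real.pi * inner ℝ q.2 (q.1 j))| := by fun_prop
  have hint : Integrable (fun q : (Fin n → E m) × E m =>
      ∏ j, |Real.cos (Real.pi * inner ℝ q.2 (q.1 j))|) (P.prod (volume.restrict A)) := by
    refine Integrable.of_bound hcont.aestronglyMeasurable 1 (Filter.Eventually.of_forall fun q => ?_)
    rw [Real.norm_of_nonneg (Finset.prod_nonneg fun _ _ => abs_nonneg _)]
    exact Finset.prod_le_one (fun _ _ => abs_nonneg _) fun _ _ => Real.abs_cos_le_one _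
  have hmean : ∫ x, (∫ θ in A, ∏ j, |Real.cos (Real.pi * inner ℝ θ (x j))|) ∂P ≤
      Real.exp (-2 * (n * a ^ 2)) * volume.real A := by
    rw [integral_integral_swap hint]
    calc ∫ θ in A, (∫ x, ∏ j, |Real.cos (Real.pi * inner ℝ θ (x j))| ∂P)
        ≤ ∫ _θ in A, Real.exp (-2 * (n * a ^ 2)) := by
          refine setIntegral_mono_on hint.integral_prod_right (integrable_const _) hA fun θ hθ => ?_
          rw [integral_fintype_prod_eq_pow (fun y : E m => |Real.cos (Real.pi * inner ℝ θ y)|),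
            Fintype.card_fin]
          calc (∫ y, |Real.cos (Real.pi * inner ℝ θ y)| ∂μ) ^ n
              ≤ Real.exp (-2 * tilde μ θ ^ 2) ^ n :=
                pow_le_pow_left₀ (integral_nonneg fun _ => abs_nonneg _) (integral_abs_cos_le μ θ) n
            _ = Real.exp (-2 * (n * tilde μ θ ^ 2)) := by
                rw [← Real.exp_nat_mul]; congr 1; ring
            _ ≤ _ := by
                have := htilde θ hθ
                rw [Real.exp_le_exp]
                have : (n : ℝ) * a ^ 2 ≤ n * tilde μ θ ^ 2 := by gcongr
                linarith
      _ = _ := by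
          rw [setIntegral_const, smul_eq_mul, mul_comm]
  rw [le_div_iff₀ hδ, mul_comm]
  exact (mul_meas_ge_le_integral_of_nonneg (Filter.Eventually.of_forall fun x =>
    integral_nonneg fun θ => Finset.prod_nonneg fun _ _ => abs_nonneg _)
    hint.integral_prod_left δ).trans hmean

/-! ### Consequences of the lower bound on `n` -/

/-- The consequences of `n ≥ c₀ m² L² (log m + log L)²` for large `n`, through `t = √n / (m L)`:
since `log n = 2 log t + 2 log (m L)` and `log (m L)` is at most a small multiple of `t`, the
ratio `t` dominates `log n`. The assumption `n > 9 · 2304²` is needed only if `m L` is bounded. -/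
theorem log_le_of_large {m n : ℕ} (hm : 0 < m) {L : ℝ} (hL : 1 ≤ L) (hn : 9 * 2304 ^ 2 < n)
    (hthr : (2304 : ℝ) ^ 2 * (m ^ 2 * L ^ 2 * (Real.log m + Real.log L) ^ 2) ≤ n) :
    2304 * (m * L) ≤ Real.sqrt n ∧ 6 * (m * Real.log n) ≤ Real.sqrt n / L := by
  have hm1 : (1 : ℝ) ≤ m := by exact_mod_cast hm
  have hnR : (9 * 2304 ^ 2 : ℝ) < n := by exact_mod_cast hn
  have hn0 : (0 : ℝ) < n := by linarith
  have hlm := Real.log_nonneg hm1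
  have hlL := Real.log_nonneg hL
  set N := Real.sqrt n with hN
  have hN0 : 0 < N := Real.sqrt_pos.mpr hn0
  have hNsq : N ^ 2 = n := Real.sq_sqrt hn0.le
  have hmL : 1 ≤ m * L := one_le_mul_of_one_le_of_one_le hm1 hL
  have hmL0 : 0 < m * L := by linarith
  have hlog : Real.log m + Real.log L = Real.log (m * L) :=
    (Real.log_mul (by positivity) (by positivity)).symm
  set ℓ := Real.log (m * L) with hℓ
  have hℓ0 : 0 ≤ ℓ := Real.log_nonneg hmL
  set t := N / (m * L) with ht
  have hNt : N = t * (m * L) := by rw [ht]; field_simp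
  have ht0 : 0 < t := by positivity
  have htℓ : 2304 * ℓ ≤ t := by
    rw [ht, le_div_iff₀ hmL0]
    refine abs_le_of_sq_le_sq' ?_ hN0.le |>.2
    rw [hNsq]
    calc (2304 * ℓ * (m * L)) ^ 2 =
          (2304 : ℝ) ^ 2 * (m ^ 2 * L ^ 2 * (Real.log m + Real.log L) ^ 2) := by
          rw [hlog]; ring
      _ ≤ (n : ℝ) := hthr
  have ht1 : 2304 ≤ t := by
    by_contra! h
    have h1 : ℓ < 1 := by linarith
    have h2 : m * L < 3 := by
      have := (Real.log_lt_iff_lt_exp hmL0).mp h1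
      linarith [Real.exp_one_lt_d9]
    have h3 : N < 2304 * 3 := by
      rw [hNt]
      exact mul_lt_mul'' h h2 ht0.le hmL0.le
    have h4 : N ^ 2 < (2304 * 3) ^ 2 := by gcongr
    rw [hNsq] at h4
    linarith
  refine ⟨?_, ?_⟩
  · rw [hNt]; gcongr
  · have hlogn : Real.log n = 2 * Real.log t + 2 * ℓ := by
      rw [← hNsq, Real.log_pow, hNt, Real.log_mul ht0.ne' hmL0.ne', hℓ]
      push_cast
      ring
    have hsq : Real.sqrt t ^ 2 = t := Real.sq_sqrt ht0.le
    -- `2304 = 48²` is where the crude bound `log t ≤ 2√t` gives `12 log t ≤ t / 2`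
    have hs48 : 48 ≤ Real.sqrt t := Real.le_sqrt_of_sq_le (by linarith)
    have hlogt : Real.log t ≤ 2 * Real.sqrt t := by
      have h1 : Real.log t = 2 * Real.log (Real.sqrt t) := by
        rw [← Real.log_rpow (Real.sqrt_pos.mpr ht0)]
        norm_num [hsq]
      have h2 := Real.log_le_sub_one_of_pos (Real.sqrt_pos.mpr ht0)
      linarith
    have h6 : 6 * Real.log n ≤ t := by
      rw [hlogn]
      nlinarith
    have hq : N / L = m * t := by rw [hNt]; field_simp
    rw [hq]
    nlinarith

theorem four_mul_le_exp_three_mul_log {n : ℕ} (hn : 2 ≤ n) :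
    (4 * n : ℝ) ≤ Real.exp (3 * Real.log n) := by
  have hn2 : (2 : ℝ) ≤ n := by exact_mod_cast hn
  have h : Real.exp (3 * Real.log n) = (n : ℝ) ^ 3 := by
    rw [mul_comm, Real.exp_mul, Real.exp_log (by linarith)]
    norm_cast
  rw [h]
  nlinarith [mul_nonneg (sub_nonneg.mpr hn2) (by linarith : (0 : ℝ) ≤ n + 2)]

/-- The Gaussian mass outside of the ball of radius `1 / (4L)` is negligible. -/
theorem gaussian_tail_le {m n : ℕ} (hm : 0 < m) (hn : 3 ≤ n) {L : ℝ} (hL : 1 ≤ L)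
    (hq : 2304 ≤ Real.sqrt n / L) (hlog : 6 * (m * Real.log n) ≤ Real.sqrt n / L) :
    2 ^ ((m : ℝ) / 2) * Real.exp (-(Real.pi ^ 2 * n / (128 * L ^ 2))) ≤
      (m : ℝ) ^ 2 * L ^ 2 / (4 * n) := by
  have hm1 : (1 : ℝ) ≤ m := by exact_mod_cast hm
  have hn3 : (3 : ℝ) ≤ n := by exact_mod_cast hn
  have hn0 : (0 : ℝ) < n := by linarith
  have hlogn : 1 ≤ Real.log n := by
    rw [Real.le_log_iff_exp_le hn0]
    linarith [Real.exp_one_lt_d9]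
  set q := Real.sqrt n / L with hqdef
  have hqsq : q ^ 2 = n / L ^ 2 := by rw [hqdef, div_pow, Real.sq_sqrt hn0.le]
  have hml : (m : ℝ) ≤ m * Real.log n := le_mul_of_one_le_right (by linarith) hlogn
  have hll : Real.log n ≤ m * Real.log n := le_mul_of_one_le_left (by linarith) hm1
  have h2 : (2 : ℝ) ^ ((m : ℝ) / 2) ≤ Real.exp m := by
    rw [Real.rpow_def_of_pos two_pos, Real.exp_le_exp]
    have := Real.log_two_lt_d9
    nlinarith
  have hexp : q ≤ Real.pi ^ 2 * n / (128 * L ^ 2) := by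
    rw [show Real.pi ^ 2 * n / (128 * L ^ 2) = Real.pi ^ 2 * (n / L ^ 2) / 128 by
      field_simp, ← hqsq]
    have hpi : 9 ≤ Real.pi ^ 2 := by nlinarith [Real.pi_gt_three]
    nlinarith [mul_le_mul_of_nonneg_right hpi (sq_nonneg q)]
  have hone : 1 ≤ (m : ℝ) ^ 2 * L ^ 2 := by
    rw [← mul_pow]
    exact one_le_pow₀ (one_le_mul_of_one_le_of_one_le hm1 hL)
  calc 2 ^ ((m : ℝ) / 2) * Real.exp (-(Real.pi ^ 2 * n / (128 * L ^ 2)))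
      ≤ Real.exp m * Real.exp (-q) := by gcongr
    _ ≤ Real.exp (-(3 * Real.log n)) := by
        rw [← Real.exp_add, Real.exp_le_exp]
        linarith
    _ ≤ 1 / (4 * n) := by
        rw [Real.exp_neg, ← one_div]
        gcongr
        exact four_mul_le_exp_three_mul_log (by omega)
    _ ≤ _ := by gcongr

theorem one_div_sqrt_le {n : ℕ} (hn : 3 ≤ n) :
    1 / Real.sqrt n ≤ Real.sqrt (Real.log n / n) := by
  have hn3 : (3 : ℝ) ≤ n := by exact_mod_cast hn
  have hn0 : (0 : ℝ) < n := by linarith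
  have hlogn : 1 ≤ Real.log n := by
    rw [Real.le_log_iff_exp_le hn0]
    linarith [Real.exp_one_lt_d9]
  rw [← Real.sqrt_one, ← Real.sqrt_div zero_le_one]
  gcongr

/-- The failure probability of the far part of the Fourier integral, for a lattice of determinant
`d`: `exp (-2√n/L) / d` bounds the mean of that integral, and the denominator is the size that can
be tolerated. All other factors are at most `exp (5√n / (4L))`, which leaves room for `1 / √n`. -/
theorem far_probability_le {m n : ℕ} (hm : 0 < m) (hn : 3 ≤ n) {L d : ℝ} (hL : 1 ≤ L) (hd : 0 < d)
    (hLn : L ≤ Real.sqrt n) (hlog : 6 * (m * Real.log n) ≤ Real.sqrt n / L)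
    (hdlog : 2 * |Real.log d| ≤ Real.sqrt n / L) :
    Real.exp (-2 * (Real.sqrt n / L)) * d⁻¹ /
      ((2 / (Real.pi * (n * L ^ 2))) ^ ((m : ℝ) / 2) * (m ^ 2 * L ^ 2 / (4 * n))) ≤
      1 / Real.sqrt n := by
  have hm1 : (1 : ℝ) ≤ m := by exact_mod_cast hm
  have hn3 : (3 : ℝ) ≤ n := by exact_mod_cast hn
  have hn0 : (0 : ℝ) < n := by linarith
  have hpi := Real.pi_pos
  have hlogn : 1 ≤ Real.log n := by
    rw [Real.le_log_iff_exp_le hn0]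
    linarith [Real.exp_one_lt_d9]
  set q := Real.sqrt n / L with hqdef
  have hml : (m : ℝ) ≤ m * Real.log n := le_mul_of_one_le_right (by linarith) hlogn
  have hll : Real.log n ≤ m * Real.log n := le_mul_of_one_le_left (by linarith) hm1
  have hLsq : L ^ 2 ≤ n := by
    rw [← Real.sq_sqrt hn0.le]
    gcongr
  have hd' : d⁻¹ ≤ Real.exp (q / 2) := by
    rw [← Real.exp_log (inv_pos.mpr hd), Real.log_inv, Real.exp_le_exp]
    linarith [neg_le_abs (Real.log d)]
  have hpow : (Real.pi * (n * L ^ 2) / 2) ^ ((m : ℝ) / 2) ≤ Real.exp (3 / 2 * (m * Real.log n)) := by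
    have h1 : Real.pi * (n * L ^ 2) / 2 ≤ (n : ℝ) ^ 3 := by
      calc Real.pi * (n * L ^ 2) / 2 ≤ 4 * (n * n) / 2 := by
            gcongr
            exact Real.pi_le_four
        _ ≤ (n : ℝ) ^ 3 := by nlinarith [mul_pos hn0 hn0]
    calc (Real.pi * (n * L ^ 2) / 2) ^ ((m : ℝ) / 2) ≤ ((n : ℝ) ^ 3) ^ ((m : ℝ) / 2) := by
          gcongr
      _ = Real.exp (3 / 2 * (m * Real.log n)) := by
          rw [Real.rpow_def_of_pos (by positivity), Real.log_pow]
          congr 1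
          push_cast
          ring
  have hone : 1 ≤ (m : ℝ) ^ 2 * L ^ 2 := by
    rw [← mul_pow]
    exact one_le_pow₀ (one_le_mul_of_one_le_of_one_le hm1 hL)
  have hfour : ((m : ℝ) ^ 2 * L ^ 2 / (4 * n))⁻¹ ≤ Real.exp (3 * Real.log n) := by
    rw [inv_div]
    refine le_trans ?_ (four_mul_le_exp_three_mul_log (n := n) (by omega))
    exact div_le_self (by positivity) hone
  have hsqrt : 1 / Real.sqrt n = Real.exp (-(Real.log n / 2)) := by
    rw [Real.exp_neg, one_div, ← Real.log_sqrt hn0.le, Real.exp_log (Real.sqrt_pos.mpr hn0)]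
  rw [div_eq_mul_inv, mul_inv, ← Real.inv_rpow (by positivity), inv_div, hsqrt]
  calc Real.exp (-2 * q) * d⁻¹ * ((Real.pi * (n * L ^ 2) / 2) ^ ((m : ℝ) / 2) *
        ((m : ℝ) ^ 2 * L ^ 2 / (4 * n))⁻¹)
      ≤ Real.exp (-2 * q) * Real.exp (q / 2) * (Real.exp (3 / 2 * (m * Real.log n)) *
        Real.exp (3 * Real.log n)) := by gcongr
    _ = Real.exp (-2 * q + q / 2 + (3 / 2 * (m * Real.log n) + 3 * Real.log n)) := by
        rw [← Real.exp_add, ← Real.exp_add, ← Real.exp_add]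
    _ ≤ _ := by
        rw [Real.exp_le_exp]
        linarith

theorem real_le_of_ofReal_mul_le {c y : ℝ} {X : ℝ≥0∞} {n : ℕ} (hc : 0 ≤ c)
    (hX : ENNReal.ofReal c * X ≤ n) (hy : ENNReal.ofReal y ≤ X) : c * y ≤ n := by
  have h : ENNReal.ofReal (c * y) ≤ (n : ℝ≥0∞) := by
    rw [ENNReal.ofReal_mul hc]
    exact (by gcongr : _ ≤ _).trans hX
  exact (ENNReal.ofReal_le_natCast).mp h

/-- The part of the threshold that involves the spanningness says that `s(X)⁴ ≥ c / (n L²)`. -/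
theorem ofReal_le_of_inv_pow_le {c L : ℝ} (hc : 1 < c) (hL : 0 < L) {n : ℕ} (hn : 0 < n)
    {s : ℝ≥0∞} (hs : ENNReal.ofReal c * (s⁻¹ ^ 4 * ENNReal.ofReal ((L ^ 2)⁻¹)) ≤ n) :
    ENNReal.ofReal (Real.sqrt (1 / (L * Real.sqrt n))) ≤ s := by
  have hn0 : (0 : ℝ) < n := by exact_mod_cast hn
  have hN := Real.sqrt_pos.mpr hn0
  set a := Real.sqrt (1 / (L * Real.sqrt n)) with ha
  have ha0 : 0 < a := Real.sqrt_pos.mpr (by positivity)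
  have ha4 : a⁻¹ ^ 4 = L ^ 2 * n := by
    rw [inv_pow, show a ^ 4 = (a ^ 2) ^ 2 by ring, ha, Real.sq_sqrt (by positivity), div_pow,
      mul_pow, Real.sq_sqrt hn0.le]
    simp
  by_contra! h
  have h1 : ENNReal.ofReal (L ^ 2 * n) ≤ s⁻¹ ^ 4 := by
    rw [← ha4, ENNReal.ofReal_pow (by positivity), ENNReal.ofReal_inv_of_pos ha0]
    gcongr
  have h2 : ENNReal.ofReal (n : ℝ) ≤ s⁻¹ ^ 4 * ENNReal.ofReal ((L ^ 2)⁻¹) := by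
    calc ENNReal.ofReal (n : ℝ) = ENNReal.ofReal (L ^ 2 * n) * ENNReal.ofReal ((L ^ 2)⁻¹) := by
          rw [← ENNReal.ofReal_mul (by positivity)]
          congr 1
          field_simp
      _ ≤ _ := by gcongr
  have h3 := real_le_of_ofReal_mul_le (by linarith) hs h2
  nlinarith

/-! ### Good matrices -/

/-- The deterministic half of the theorem: if `M Mᵀ ≥ (n / 2) I` and the Fourier integral far from
the dual lattice is small, then the matrix is good. -/
theorem goodMatrix_of_setIntegral_lt {m n : ℕ} (hm : 0 < m) (hn : 3 ≤ n) {𝓛 : Submodule ℤ (E m)}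
    [DiscreteTopology 𝓛] [IsZLattice ℝ 𝓛] {L : ℝ} (hL : 1 ≤ L)
    (hq : 2304 ≤ Real.sqrt n / L) (hlog : 6 * (m * Real.log n) ≤ Real.sqrt n / L)
    {D : Set (E m)} (hDmeas : MeasurableSet D) (hball : Metric.closedBall 0 (1 / (4 * L)) ⊆ D)
    (hD : IsAddFundamentalDomain (dualLattice 𝓛) D volume)
    (hvol : volume.real D = (ZLattice.covolume 𝓛)⁻¹) (htop : volume D ≠ ⊤)
    {x : Fin n → E m} (hx : ∀ j, x j ∈ 𝓛) (hxL : ∀ j, ‖x j‖ ≤ L)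
    (hQ : (colMatrix x * (colMatrix x).transpose -
      ((n : ℝ) / 2) • (1 : Matrix (Fin m) (Fin m) ℝ)).PosSemidef)
    (hfar : ∫ θ in D \ Metric.closedBall 0 (1 / (4 * L)),
        ∏ j, |Real.cos (Real.pi * inner ℝ θ (x j))| <
      (2 / (Real.pi * (n * L ^ 2))) ^ ((m : ℝ) / 2) * (m ^ 2 * L ^ 2 / (4 * n))) :
    GoodMatrix 𝓛 L (colMatrix x) := by
  have hm1 : (1 : ℝ) ≤ m := by exact_mod_cast hm
  have hn0 : (0 : ℝ) < n := by exact_mod_cast (by omega : 0 < n)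
  have hL0 : 0 < L := by linarith
  have hc := ZLattice.covolume_pos 𝓛
  have hlow := le_latticeGaussian_zero hm (by omega) 𝓛 hL0 hxL hQ
  set G := latticeGaussian 𝓛 (colMatrix x) 0 with hG
  have hpi := Real.pi_pos
  have hG0 : 0 < G := lt_of_lt_of_le (by positivity) hlow
  have hmain : ∀ v ∈ shiftedLattice 𝓛 (colMatrix x),
      |hitProb (colMatrix x) v - latticeGaussian 𝓛 (colMatrix x) v| ≤
        G * (2 * (m : ℝ) ^ 2 * L ^ 2 / n) := by
    intro v hv
    have h := abs_hitProb_sub_latticeGaussian_le hm (by omega) hL0 hDmeas hball hD hvol htop hx hxL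
      hQ hv
    have htail := gaussian_tail_le hm hn hL hq hlog
    have hnear : (m * (m + 2) * L ^ 2 / (2 * n) : ℝ) ≤ 3 * m ^ 2 * L ^ 2 / (2 * n) := by
      have h3 : (m * (m + 2) : ℝ) ≤ 3 * m ^ 2 := by nlinarith
      exact div_le_div_of_nonneg_right (mul_le_mul_of_nonneg_right h3 (sq_nonneg L))
        (by positivity)
    have hfar' : ZLattice.covolume 𝓛 * ∫ θ in D \ Metric.closedBall 0 (1 / (4 * L)),
        ∏ j, |Real.cos (Real.pi * inner ℝ θ (x j))| ≤ G * (m ^ 2 * L ^ 2 / (4 * n)) := by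
      calc _ ≤ ZLattice.covolume 𝓛 *
            ((2 / (Real.pi * (n * L ^ 2))) ^ ((m : ℝ) / 2) * (m ^ 2 * L ^ 2 / (4 * n))) :=
            mul_le_mul_of_nonneg_left hfar.le hc.le
        _ = (ZLattice.covolume 𝓛 * (2 / (Real.pi * (n * L ^ 2))) ^ ((m : ℝ) / 2)) *
            (m ^ 2 * L ^ 2 / (4 * n)) := by ring
        _ ≤ G * (m ^ 2 * L ^ 2 / (4 * n)) :=
          mul_le_mul_of_nonneg_right hlow (by positivity)
    calc _ ≤ _ := h
      _ ≤ G * (3 * m ^ 2 * L ^ 2 / (2 * n) + (m : ℝ) ^ 2 * L ^ 2 / (4 * n)) +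
          G * (m ^ 2 * L ^ 2 / (4 * n)) := by gcongr
      _ = _ := by field_simp; ring
  refine ⟨hQ, hmain, fun v hv hlt => ?_⟩
  have h := (abs_le.mp (hmain v hv)).1
  rw [latticeGaussian_eq_mul_gaussExp] at h
  have := mul_lt_mul_of_pos_left hlt hG0
  linarith

end LatticeLLT

open LatticeLLT
theorem mainTheorem2 :
    ∃ c₀ c₁ : ℝ, 0 < c₀ ∧ 0 < c₁ ∧
      ∀ (m : ℕ) (_ : 0 < m)
        (𝓛 : Submodule ℤ (E m)) (_ : DiscreteTopology 𝓛)
        (μ : Measure (E m)) (_ : IsProbabilityMeasure μ) (L : ℝ) (_ : 0 < L)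
        (_ : ∀ᵐ x ∂μ, x ∈ 𝓛)
        (_ : secondMoment μ = 1)
        (_ : μ.support ⊆ Metric.closedBall 0 L)
        (_ : 𝓛 = Submodule.span ℤ μ.support)
        (n : ℕ) (_ : 2 ≤ n)
        (_ : threshold c₀ m (spanningness μ 𝓛) L (ZLattice.covolume 𝓛) ≤ (n : ℝ≥0∞)),
        1 - c₁ * L * Real.sqrt (Real.log n / n) ≤
          (Measure.pi fun _ : Fin n => μ).real
            {x : Fin n → E m | GoodMatrix 𝓛 L (colMatrix x)} := by
  refine ⟨2304 ^ 2, 9 * 2304 ^ 2, by norm_num, by norm_num, ?_⟩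
  intro m hm 𝓛 _ μ _ L hL0 hmem hsm hsupp _ n hn2 hthr
  have hbd := ae_norm_le_of_support_subset hsupp
  have hm1 : (1 : ℝ) ≤ m := by exact_mod_cast hm
  have hn0 : (0 : ℝ) < n := by exact_mod_cast (by omega : 0 < n)
  have hL : 1 ≤ L := by
    have h := hm1.trans (nat_le_sq_of_isotropic hbd hsm)
    exact (one_le_sq_iff₀ hL0.le).mp h
  set P := Measure.pi fun _ : Fin n => μ
  set S := {x : Fin n → E m | GoodMatrix 𝓛 L (colMatrix x)}
  by_cases hbig : 9 * 2304 ^ 2 < n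
  swap
  · -- for bounded `n` the claimed lower bound is not positive, because `L ≥ 1`
    refine le_trans ?_ measureReal_nonneg
    have hnle : (n : ℝ) ≤ 9 * 2304 ^ 2 := by exact_mod_cast not_lt.mp hbig
    have hlog2 : 1 / 2 ≤ Real.log n := by
      have h1 : Real.log 2 ≤ Real.log n :=
        Real.log_le_log two_pos (by exact_mod_cast hn2)
      linarith [Real.log_two_gt_d9]
    have h1 : 1 / (9 * 2304 ^ 2) ≤ Real.sqrt (Real.log n / n) := by
      refine Real.le_sqrt_of_sq_le ?_
      calc (1 / (9 * 2304 ^ 2) : ℝ) ^ 2 ≤ (1 / 2) / (9 * 2304 ^ 2) := by norm_num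
        _ ≤ Real.log n / n := by gcongr
    have h2 : (1 : ℝ) ≤ 9 * 2304 ^ 2 * Real.sqrt (Real.log n / n) := by
      rw [div_le_iff₀ (by norm_num)] at h1
      linarith
    nlinarith [Real.sqrt_nonneg (Real.log n / n)]
  have hn3 : 3 ≤ n := by omega
  have hZ := isZLattice_of_isotropic hbd hmem hsm
  have hc := ZLattice.covolume_pos 𝓛
  rw [threshold] at hthr
  have hthr1 : (2304 : ℝ) ^ 2 * (m ^ 2 * L ^ 2 * (Real.log m + Real.log L) ^ 2) ≤ n :=
    real_le_of_ofReal_mul_le (by norm_num) hthr (le_max_left _ _)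
  have hthr3 : (2304 : ℝ) ^ 2 * (L ^ 2 * Real.log (ZLattice.covolume 𝓛) ^ 2) ≤ n :=
    real_le_of_ofReal_mul_le (by norm_num) hthr ((le_max_right _ _).trans (le_max_right _ _))
  have hspan := ofReal_le_of_inv_pow_le (c := 2304 ^ 2) (L := L) (n := n) (by norm_num) hL0
    (by omega) (le_trans (by gcongr; exact (le_max_left _ _).trans (le_max_right _ _)) hthr)
  obtain ⟨hmL, hlog⟩ := log_le_of_large hm hL hbig hthr1
  set N := Real.sqrt n with hN
  have hN0 : 0 < N := Real.sqrt_pos.mpr hn0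
  have hNsq : N ^ 2 = n := Real.sq_sqrt hn0.le
  have hLm : L ≤ m * L := le_mul_of_one_le_left hL0.le hm1
  have hq : 2304 ≤ N / L := by
    rw [le_div_iff₀ hL0]
    linarith
  have hLN : L ≤ N := by linarith
  have hdlog : 2 * |Real.log (ZLattice.covolume 𝓛)| ≤ N / L := by
    rw [le_div_iff₀ hL0]
    refine (abs_le_of_sq_le_sq' ?_ hN0.le).2
    rw [hNsq, mul_pow, mul_pow, sq_abs]
    nlinarith [mul_nonneg (sq_nonneg L) (sq_nonneg (Real.log (ZLattice.covolume 𝓛)))]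
  have hsep : ∀ z ∈ dualLattice 𝓛, z ≠ 0 → 2 * (1 / (4 * L)) < ‖z‖ := fun z hz hz0 => by
    refine lt_of_lt_of_le ?_ (one_div_le_norm_of_mem_dualLattice hL0 hbd hmem hsm hz hz0)
    rw [show 2 * (1 / (4 * L)) = 1 / L * (1 / 2) by field_simp; norm_num]
    have : 0 < 1 / L := by positivity
    linarith
  obtain ⟨D, hDmeas, hball, hD, hvol, htop, hDfar⟩ := exists_dual_domain 𝓛 hsep
  set A := D \ Metric.closedBall 0 (1 / (4 * L)) with hA
  -- both `s(X)` and half of the distance to the dual lattice are at least `a`, and `n a² = √n / L`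
  set a := Real.sqrt (1 / (L * N)) with ha
  have hasq : a ^ 2 = 1 / (L * N) := Real.sq_sqrt (by positivity)
  have har : a ≤ 1 / (4 * L) / 2 := by
    refine abs_le_of_sq_le_sq' ?_ (by positivity) |>.2
    rw [hasq, show (1 / (4 * L) / 2) ^ 2 = 1 / (L * (64 * L)) by field_simp; norm_num]
    gcongr
    linarith
  have htilde : ∀ θ ∈ A, a ≤ tilde μ θ := fun θ hθ =>
    le_tilde_of_le_spanningness (by positivity) har hspan (hDfar θ hθ)
  set δ := (2 / (Real.pi * (n * L ^ 2))) ^ ((m : ℝ) / 2) * ((m : ℝ) ^ 2 * L ^ 2 / (4 * n)) with hδ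
  have hpi := Real.pi_pos
  have hδ0 : 0 < δ := by positivity
  set F := {x : Fin n → E m | ((n : ℝ) / 2) ^ 2 ≤
    ∑ i, ∑ k, ((colMatrix x * (colMatrix x).transpose) i k -
      n * (1 : Matrix (Fin m) (Fin m) ℝ) i k) ^ 2} with hF
  set R := {x : Fin n → E m | δ ≤ ∫ θ in A, ∏ j, |Real.cos (Real.pi * inner ℝ θ (x j))|} with hR
  have hsqrt := one_div_sqrt_le hn3
  have hFle : P.real F ≤ L * Real.sqrt (Real.log n / n) := by
    calc P.real F ≤ 4 * (m * L ^ 2) / n := measure_frobenius_le (by omega) hbd hsm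
      _ = (4 * (m * L)) * L / (N * N) := by rw [← sq, hNsq]; ring
      _ ≤ N * L / (N * N) := by
          gcongr
          linarith [mul_pos (by linarith : (0 : ℝ) < m) hL0]
      _ = L * (1 / N) := by field_simp
      _ ≤ _ := by gcongr
  have hRle : P.real R ≤ L * Real.sqrt (Real.log n / n) := by
    have hAtop : volume A ≠ ⊤ := measure_ne_top_of_subset Set.sdiff_subset htop
    have hAvol : volume.real A ≤ (ZLattice.covolume 𝓛)⁻¹ := by
      rw [← hvol]
      exact measureReal_mono Set.sdiff_subset htop
    have hna : (n : ℝ) * a ^ 2 = N / L := by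
      rw [hasq, ← hNsq]
      field_simp
    calc P.real R ≤ Real.exp (-2 * (n * a ^ 2)) * volume.real A / δ :=
          measure_setIntegral_prod_abs_cos_le μ (hDmeas.diff measurableSet_closedBall) hAtop
            (Real.sqrt_nonneg _) hδ0 htilde
      _ ≤ Real.exp (-2 * (N / L)) * (ZLattice.covolume 𝓛)⁻¹ / δ := by
          rw [hna]
          gcongr
      _ ≤ 1 / N := far_probability_le hm hn3 hL hc hLN hlog hdlog
      _ ≤ Real.sqrt (Real.log n / n) := hsqrt
      _ ≤ _ := le_mul_of_one_le_left (Real.sqrt_nonneg _) hL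
  have hae : ∀ᵐ x ∂P, ∀ j, x j ∈ 𝓛 ∧ ‖x j‖ ≤ L :=
    ae_all_iff.mpr fun j => (measurePreserving_eval (fun _ : Fin n => μ) j).quasiMeasurePreserving.ae
      (hmem.and hbd)
  have hcover : ∀ᵐ x ∂P, x ∈ S ∪ (F ∪ R) := by
    filter_upwards [hae] with x hx
    by_cases hxF : x ∈ F
    · exact Or.inr (Or.inl hxF)
    by_cases hxR : x ∈ R
    · exact Or.inr (Or.inr hxR)
    refine Or.inl ?_
    have hQ := posSemidef_of_frobenius_le (n := n)
      (Q := colMatrix x * (colMatrix x).transpose)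
      (by simpa using Matrix.isHermitian_mul_conjTranspose_self (colMatrix x)) (not_le.mp hxF).le
    exact goodMatrix_of_setIntegral_lt hm hn3 hL hq hlog hDmeas hball hD hvol htop
      (fun j => (hx j).1) (fun j => (hx j).2) hQ (not_le.mp hxR)
  have hone : P.real (S ∪ (F ∪ R)) = 1 := by
    have huniv : (S ∪ (F ∪ R) : Set (Fin n → E m)) =ᵐ[P] Set.univ :=
      Filter.eventuallyEq_univ.mpr hcover
    rw [measureReal_congr huniv]
    simp [P]
  have hunion := (measureReal_union_le (μ := P) S (F ∪ R)).trans
    (add_le_add_right (measureReal_union_le (μ := P) F R) _)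
  rw [hone] at hunion
  have hnn : 0 ≤ L * Real.sqrt (Real.log n / n) := by positivity
  linarith
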